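/- Let $M$ be a smooth (finite-dimensional, Hausdorff, second countable) manifold. A double vector bundle $(D;A,E;M)$ is a commutative square of smooth real vector bundles of finite rank $p_D:D\to E$, $p:D\to A$, $p_E:E\to M$, $p_A:A\to M$ in which $p_D$ is a vector bundle morphism over $p_A$ and the addition $+_E:D\times_E D\to D$ of $D\to E$ is a vector bundle morphism over the addition $A\times_M A\to A$. Its core is $C=\ker p\cap\ker p_D$, a vector bundle over $M$ included in $D$ by $c\mapsto\bar c$. A smooth section of $D\to E$ is *linear* over $a\in\Gamma(A)$ if it is a vector bundle morphism from $E\to M$ to $D\to A$ covering $a$; it is a *core section* if it has the form $e\mapsto 0^D_e+_A\overline{c(p_E(e))}$ with $c\in\Gamma(C)$. A *VB-algebroid* is a double vector bundle with Lie algebroid structures on $D\to E$ and on $A\to M$ such that $\rho_D:D\to TE$ is a vector bundle morphism from $D\to A$ to $TE\to TM$ over $\rho_A:A\to TM$; the bracket of two linear sections over $a$ and $b$ is a linear section over $[a,b]_A$; the bracket of a linear section and a core section is a core section; and any two core sections commute. A Lie algebroid *extension* is a fibrewise surjective Lie algebroid morphism over a surjective submersion; an *Ehresmann connection* on it is a smooth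 vector subbundle $H$ complementary to its kernel; it is *complete* if for every section $a$ of the target with complete anchor vector field $\rho(a)$ the anchor vector field of the horizontal lift of $a$ (the section of $H$ that projects to $a$) is complete. A *fibration* of Lie algebroids is an extension that admits a complete Ehresmann connection. **Proposition.** Let $(D;A,E;M)$ be a VB-algebroid with core $C$. Then $p:D\to A$ is a Lie algebroid fibration over $p_E:E\to M$. Its kernel $\ker p\to E$ is a Lie subalgebroid of $D\to E$; the core carries a smooth vector bundle structure over $M$ for which its inclusion into $D$ is smooth, and for any such structure $(e,c)\mapsto 0^D_e+_A\bar c$ is an isomorphism of vector bundles over $E$ from $p_E^*C$ onto $\ker p$. Moreover, Ehresmann connections on $p$ that are linear (all horizontal lifts of sections of $A$ are linear sections of $D\to E$) exist, and every linear Ehresmann connection is complete. -/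

import Mathlib

open Bundle Manifold
open scoped Manifold ContDiff Bundle Topology

noncomputable section

/-! ### Fibrewise operations on the total space of a vector bundle -/

section Fibrewise

variable {B : Type*} {F : Type*} {V : B → Type*} [∀ b, AddCommGroup (V b)] [∀ b, Module ℝ (V b)]

/-- `x`, `y`, `z` lie in one fibre and `z = x + y` there. -/
def FibreSum (x y z : TotalSpace F V) : Prop :=
  ∃ (b : B) (u v : V b), x = ⟨b, u⟩ ∧ y = ⟨b, v⟩ ∧ z = ⟨b, u + v⟩

/-- Fibrewise multiplication by the scalar `t`. -/
def fibreSMul (t : ℝ) (x : TotalSpace F V) : TotalSpace F V := ⟨x.proj, t • x.snd⟩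

end Fibrewise

/-! ### Vector bundles: subbundles, Lie algebroids -/

section LieAlgebroid

variable {EB : Type*} [NormedAddCommGroup EB] [NormedSpace ℝ EB]
  {HB : Type*} [TopologicalSpace HB] (IB : ModelWithCorners ℝ EB HB)
  {B : Type*} [TopologicalSpace B] [ChartedSpace HB B] [IsManifold IB ∞ B]
  (F : Type*) [NormedAddCommGroup F] [NormedSpace ℝ F]
  (V : B → Type*) [TopologicalSpace (TotalSpace F V)]
  [∀ b, AddCommGroup (V b)] [∀ b, Module ℝ (V b)] [∀ b, TopologicalSpace (V b)]
  [FiberBundle F V]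

/-- The derivative of a real function `f` at `b` along the tangent vector `ξ`. -/
def derivAlong (f : B → ℝ) (b : B) (ξ : TangentSpace IB b) : ℝ :=
  (mfderiv IB 𝓘(ℝ, ℝ) f b : TangentSpace IB b →L[ℝ] ℝ) ξ

/-- A vector field is complete if through every point passes an integral curve defined on `ℝ`. -/
def IsCompleteVectorField (Z : (b : B) → TangentSpace IB b) : Prop :=
  ∀ b : B, ∃ γ : ℝ → B, γ 0 = b ∧ IsMIntegralCurve (I := IB) γ Z

variable {V} in
/-- A family of subspaces of the fibres is a smooth vector subbundle if it is locally spanned by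
a smooth frame. -/
def IsSmoothSubbundle (S : (b : B) → Submodule ℝ (V b)) : Prop :=
  ∀ b₀ : B, ∃ U : Set B, IsOpen U ∧ b₀ ∈ U ∧ ∃ (k : ℕ) (s : Fin k → (b : B) → V b),
    (∀ i, ContMDiffOn IB (IB.prod 𝓘(ℝ, F)) ∞ (fun b => (⟨b, s i b⟩ : TotalSpace F V)) U) ∧
    ∀ b ∈ U, LinearIndependent ℝ (fun i => s i b) ∧
      Submodule.span ℝ (Set.range fun i => s i b) = S b

variable [VectorBundle ℝ F V]

/-- A Lie algebroid structure on the vector bundle `V → B`. -/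
structure LieAlgebroid where
  anchor : (b : B) → V b →ₗ[ℝ] TangentSpace IB b
  contMDiff_anchor : ContMDiff (IB.prod 𝓘(ℝ, F)) IB.tangent ∞
    (fun x : TotalSpace F V => (⟨x.proj, anchor x.proj x.snd⟩ : TangentBundle IB B))
  bracket : Cₛ^∞⟮IB; F, V⟯ →ₗ[ℝ] Cₛ^∞⟮IB; F, V⟯ →ₗ[ℝ] Cₛ^∞⟮IB; F, V⟯
  bracket_self : ∀ X, bracket X X = 0
  jacobi : ∀ X Y Z, bracket X (bracket Y Z) = bracket (bracket X Y) Z + bracket Y (bracket X Z)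
  /-- `[X, fY] = f [X, Y] + (ρ(X) f) Y`. -/
  leibniz : ∀ (X Y fY : Cₛ^∞⟮IB; F, V⟯) (f : C^∞⟮IB, B; ℝ⟯), (∀ b, fY b = f b • Y b) →
    ∀ b, bracket X fY b = f b • bracket X Y b + derivAlong IB f b (anchor b (X b)) • Y b

variable {IB F V}

/-- The vector field `ρ(X)`. -/
def LieAlgebroid.anchorField (L : LieAlgebroid IB F V) (X : Cₛ^∞⟮IB; F, V⟯) (b : B) :
    TangentSpace IB b := L.anchor b (X b)

/-- A Lie subalgebroid over the same base: a smooth subbundle whose sections are closed under the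
bracket. -/
structure LieAlgebroid.IsLieSubalgebroid (L : LieAlgebroid IB F V)
    (S : (b : B) → Submodule ℝ (V b)) : Prop where
  isSmoothSubbundle : IsSmoothSubbundle IB F S
  bracket_mem : ∀ X Y : Cₛ^∞⟮IB; F, V⟯, (∀ b, X b ∈ S b) → (∀ b, Y b ∈ S b) →
    ∀ b, L.bracket X Y b ∈ S b

end LieAlgebroid

/-! ### Morphisms, extensions and fibrations of Lie algebroids -/

section Fibration

variable {EB : Type*} [NormedAddCommGroup EB] [NormedSpace ℝ EB]
  {HB : Type*} [TopologicalSpace HB] {IB : ModelWithCorners ℝ EB HB}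
  {B : Type*} [TopologicalSpace B] [ChartedSpace HB B] [IsManifold IB ∞ B]
  {F : Type*} [NormedAddCommGroup F] [NormedSpace ℝ F]
  {V : B → Type*} [TopologicalSpace (TotalSpace F V)]
  [∀ b, AddCommGroup (V b)] [∀ b, Module ℝ (V b)] [∀ b, TopologicalSpace (V b)]
  [FiberBundle F V] [VectorBundle ℝ F V]
  {EB' : Type*} [NormedAddCommGroup EB'] [NormedSpace ℝ EB']
  {HB' : Type*} [TopologicalSpace HB'] {IB' : ModelWithCorners ℝ EB' HB'}
  {B' : Type*} [TopologicalSpace B'] [ChartedSpace HB' B'] [IsManifold IB' ∞ B']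
  {F' : Type*} [NormedAddCommGroup F'] [NormedSpace ℝ F']
  {W : B' → Type*} [TopologicalSpace (TotalSpace F' W)]
  [∀ b, AddCommGroup (W b)] [∀ b, Module ℝ (W b)] [∀ b, TopologicalSpace (W b)]
  [FiberBundle F' W] [VectorBundle ℝ F' W]
  (LV : LieAlgebroid IB F V) (LW : LieAlgebroid IB' F' W)
  (f : B → B') (φ : (b : B) → V b →ₗ[ℝ] W (f b))

/-- `φ : V → W` is a morphism of Lie algebroids over `f : B → B'`: a smooth vector bundle map
which is compatible with the anchors and with the brackets. The latter is expressed through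
decompositions `φ ∘ X = ∑ uᵢ (aᵢ ∘ f)` and `φ ∘ Y = ∑ vⱼ (cⱼ ∘ f)`. -/
structure IsLieAlgebroidMorphism : Prop where
  contMDiff_base : ContMDiff IB IB' ∞ f
  contMDiff_map : ContMDiff (IB.prod 𝓘(ℝ, F)) (IB'.prod 𝓘(ℝ, F')) ∞
    (fun x : TotalSpace F V => (⟨f x.proj, φ x.proj x.snd⟩ : TotalSpace F' W))
  anchor_map : ∀ (b : B) (v : V b),
    LW.anchor (f b) (φ b v) = mfderiv IB IB' f b (LV.anchor b v)
  bracket_map : ∀ (X Y : Cₛ^∞⟮IB; F, V⟯) (k l : ℕ)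
    (u : Fin k → C^∞⟮IB, B; ℝ⟯) (a : Fin k → Cₛ^∞⟮IB'; F', W⟯)
    (v : Fin l → C^∞⟮IB, B; ℝ⟯) (c : Fin l → Cₛ^∞⟮IB'; F', W⟯),
    (∀ b, φ b (X b) = ∑ i, u i b • a i (f b)) →
    (∀ b, φ b (Y b) = ∑ j, v j b • c j (f b)) →
    ∀ b, φ b (LV.bracket X Y b) =
      ∑ i, ∑ j, (u i b * v j b) • LW.bracket (a i) (c j) (f b)
      + ∑ j, derivAlong IB (v j) b (LV.anchor b (X b)) • c j (f b)
      - ∑ i, derivAlong IB (u i) b (LV.anchor b (Y b)) • a i (f b)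

/-- An extension of Lie algebroids: a (fibrewise) surjective morphism over a surjective
submersion. -/
structure IsLieAlgebroidExtension : Prop where
  isMorphism : IsLieAlgebroidMorphism LV LW f φ
  surjective_base : Function.Surjective f
  isSubmersion_base : IsSubmersion IB IB' ∞ f
  surjective_map : ∀ b, Function.Surjective (φ b)

variable (IB F) in
/-- An Ehresmann connection: a smooth subbundle complementary to the kernel of `φ`. -/
structure EhresmannConnection where
  H : (b : B) → Submodule ℝ (V b)
  isSmoothSubbundle : IsSmoothSubbundle IB F H
  isCompl : ∀ b, IsCompl (LinearMap.ker (φ b)) (H b)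

variable {f φ} in
/-- `X` is the horizontal lift `hor(a)` of the section `a`. -/
def EhresmannConnection.IsHorizontalLift (h : EhresmannConnection IB F f φ)
    (a : Cₛ^∞⟮IB'; F', W⟯) (X : Cₛ^∞⟮IB; F, V⟯) : Prop :=
  (∀ b, X b ∈ h.H b) ∧ ∀ b, φ b (X b) = a (f b)

variable {f φ} in
/-- The connection is complete: if `ρ(a)` is complete, so is `ρ(hor(a))`. -/
def EhresmannConnection.IsComplete (h : EhresmannConnection IB F f φ) : Prop :=
  ∀ a : Cₛ^∞⟮IB'; F', W⟯, IsCompleteVectorField IB' (LW.anchorField a) →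
    ∃ X : Cₛ^∞⟮IB; F, V⟯, h.IsHorizontalLift a X ∧ IsCompleteVectorField IB (LV.anchorField X)

/-- A fibration of Lie algebroids: an extension that admits a complete Ehresmann connection. -/
structure IsLieAlgebroidFibration : Prop where
  isExtension : IsLieAlgebroidExtension LV LW f φ
  exists_complete : ∃ h : EhresmannConnection IB F f φ, h.IsComplete LV LW

end Fibration

/-! ### The vector bundle `TE → TM` -/

section TangentProlongation

variable {EM : Type*} [NormedAddCommGroup EM] [NormedSpace ℝ EM]
  {M : Type*} [TopologicalSpace M] [ChartedSpace EM M]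
  {FE : Type*} [NormedAddCommGroup FE] [NormedSpace ℝ FE]
  {E : M → Type*} [TopologicalSpace (TotalSpace FE E)]
  [∀ m, AddCommGroup (E m)] [∀ m, Module ℝ (E m)] [∀ m, TopologicalSpace (E m)]
  [FiberBundle FE E] [VectorBundle ℝ FE E]

/-- Addition in the vector bundle `TE → TM`, that is, the tangent map of the addition
`E ×_M E → E`: `ζ = T(+)(ξ, η)`. -/
def TangentSum (ξ η ζ : TangentBundle (𝓘(ℝ, EM).prod 𝓘(ℝ, FE)) (TotalSpace FE E)) : Prop :=
  ∃ w : TangentBundle (𝓘(ℝ, EM).prod 𝓘(ℝ, FE × FE)) (TotalSpace (FE × FE) (E ×ᵇ E)),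
    tangentMap (𝓘(ℝ, EM).prod 𝓘(ℝ, FE × FE)) (𝓘(ℝ, EM).prod 𝓘(ℝ, FE))
      (fun x : TotalSpace (FE × FE) (E ×ᵇ E) => (⟨x.proj, x.snd.1⟩ : TotalSpace FE E)) w = ξ ∧
    tangentMap (𝓘(ℝ, EM).prod 𝓘(ℝ, FE × FE)) (𝓘(ℝ, EM).prod 𝓘(ℝ, FE))
      (fun x : TotalSpace (FE × FE) (E ×ᵇ E) => (⟨x.proj, x.snd.2⟩ : TotalSpace FE E)) w = η ∧
    tangentMap (𝓘(ℝ, EM).prod 𝓘(ℝ, FE × FE)) (𝓘(ℝ, EM).prod 𝓘(ℝ, FE))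
      (fun x : TotalSpace (FE × FE) (E ×ᵇ E) =>
        (⟨x.proj, x.snd.1 + x.snd.2⟩ : TotalSpace FE E)) w = ζ

end TangentProlongation

/-! ### Double vector bundles and VB-algebroids -/

section VBAlgebroid

variable {EM : Type*} [NormedAddCommGroup EM] [NormedSpace ℝ EM]
  {M : Type*} [TopologicalSpace M] [ChartedSpace EM M]
  (FA : Type*) [NormedAddCommGroup FA] [NormedSpace ℝ FA]
  (A : M → Type*) [TopologicalSpace (TotalSpace FA A)]
  [∀ m, AddCommGroup (A m)] [∀ m, Module ℝ (A m)] [∀ m, TopologicalSpace (A m)]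
  [FiberBundle FA A] [VectorBundle ℝ FA A]
  (FE : Type*) [NormedAddCommGroup FE] [NormedSpace ℝ FE]
  (E : M → Type*) [TopologicalSpace (TotalSpace FE E)]
  [∀ m, AddCommGroup (E m)] [∀ m, Module ℝ (E m)] [∀ m, TopologicalSpace (E m)]
  [FiberBundle FE E] [VectorBundle ℝ FE E]
  (F₁ : Type*) [NormedAddCommGroup F₁] [NormedSpace ℝ F₁]
  (D₁ : TotalSpace FE E → Type*) [TopologicalSpace (TotalSpace F₁ D₁)]
  [∀ e, AddCommGroup (D₁ e)] [∀ e, Module ℝ (D₁ e)] [∀ e, TopologicalSpace (D₁ e)]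
  [FiberBundle F₁ D₁] [VectorBundle ℝ F₁ D₁]
  (F₂ : Type*) [NormedAddCommGroup F₂] [NormedSpace ℝ F₂]
  (D₂ : TotalSpace FA A → Type*) [TopologicalSpace (TotalSpace F₂ D₂)]
  [∀ a, AddCommGroup (D₂ a)] [∀ a, Module ℝ (D₂ a)] [∀ a, TopologicalSpace (D₂ a)]
  [FiberBundle F₂ D₂] [VectorBundle ℝ F₂ D₂]

/-- A double vector bundle `(D; A, E; M)`. The manifold `D` with its vector bundle structure over
`E` is the total space of `D₁`, the same manifold with its vector bundle structure over `A` is the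
total space of `D₂`, and `flip` identifies the two. -/
structure DoubleVectorBundle where
  flip : TotalSpace F₁ D₁ ≃ₘ⟮(𝓘(ℝ, EM).prod 𝓘(ℝ, FE)).prod 𝓘(ℝ, F₁),
    (𝓘(ℝ, EM).prod 𝓘(ℝ, FA)).prod 𝓘(ℝ, F₂)⟯ TotalSpace F₂ D₂
  /-- The projection `p : D → A`, on the fibre of `D → E` over `e`. -/
  p : (e : TotalSpace FE E) → D₁ e →ₗ[ℝ] A e.proj
  proj_flip : ∀ (e : TotalSpace FE E) (d : D₁ e), (flip ⟨e, d⟩).proj = ⟨e.proj, p e d⟩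
  /-- The projection `p_D : D → E`, on the fibre of `D → A` over `a`. -/
  pD : (a : TotalSpace FA A) → D₂ a →ₗ[ℝ] E a.proj
  proj_flip_symm : ∀ (a : TotalSpace FA A) (d : D₂ a),
    (flip.symm ⟨a, d⟩).proj = ⟨a.proj, pD a d⟩
  /-- `(d₁ +_A d₂) +_E (d₃ +_A d₄) = (d₁ +_E d₃) +_A (d₂ +_E d₄)`. -/
  interchange : ∀ d₁ d₂ d₃ d₄ d₁₂ d₃₄ d₁₃ d₂₄ d : TotalSpace F₁ D₁,
    FibreSum (flip d₁) (flip d₂) (flip d₁₂) → FibreSum (flip d₃) (flip d₄) (flip d₃₄) →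
    FibreSum d₁ d₃ d₁₃ → FibreSum d₂ d₄ d₂₄ →
    FibreSum d₁₂ d₃₄ d → FibreSum (flip d₁₃) (flip d₂₄) (flip d)
  /-- `(t ·_A d₁) +_E (t ·_A d₂) = t ·_A (d₁ +_E d₂)`. -/
  smul_interchange : ∀ (t : ℝ) (d₁ d₂ d : TotalSpace F₁ D₁), FibreSum d₁ d₂ d →
    FibreSum (flip.symm (fibreSMul t (flip d₁))) (flip.symm (fibreSMul t (flip d₂)))
      (flip.symm (fibreSMul t (flip d)))

variable {FA A FE E F₁ D₁ F₂ D₂}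

namespace DoubleVectorBundle

variable (𝒟 : DoubleVectorBundle (EM := EM) FA A FE E F₁ D₁ F₂ D₂)

/-- `d = d₁ +_A d₂`. -/
def SumA (d₁ d₂ d : TotalSpace F₁ D₁) : Prop := FibreSum (𝒟.flip d₁) (𝒟.flip d₂) (𝒟.flip d)

/-- `t ·_A d`. -/
def smulA (t : ℝ) (d : TotalSpace F₁ D₁) : TotalSpace F₁ D₁ :=
  𝒟.flip.symm (fibreSMul t (𝒟.flip d))

/-- The fibre over `m` of the core: the elements of `D` over `0 ∈ E_m` and over `0 ∈ A_m`. -/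
def core (m : M) : Submodule ℝ (D₁ ⟨m, 0⟩) := LinearMap.ker (𝒟.p ⟨m, 0⟩)

/-- The core bundle, as a family of vector spaces over `M`. -/
abbrev Core (m : M) : Type _ := 𝒟.core m

/-- The inclusion `c ↦ c̄` of the core into `D`. -/
def coreIncl (m : M) (c : 𝒟.Core m) : TotalSpace F₁ D₁ := ⟨⟨m, 0⟩, (c : D₁ ⟨m, 0⟩)⟩

/-- A section `X` of `D → E` is linear over the section `a` of `A`: it is a vector bundle morphism
from `E → M` to `D → A` covering `a`. -/
structure IsLinearSection (X : Cₛ^∞⟮𝓘(ℝ, EM).prod 𝓘(ℝ, FE); F₁, D₁⟯)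
    (a : Cₛ^∞⟮𝓘(ℝ, EM); FA, A⟯) : Prop where
  covers : ∀ e, 𝒟.p e (X e) = a e.proj
  map_add : ∀ e₁ e₂ e : TotalSpace FE E, FibreSum e₁ e₂ e →
    𝒟.SumA ⟨e₁, X e₁⟩ ⟨e₂, X e₂⟩ ⟨e, X e⟩
  map_smul : ∀ (t : ℝ) (e : TotalSpace FE E),
    (⟨fibreSMul t e, X (fibreSMul t e)⟩ : TotalSpace F₁ D₁) = 𝒟.smulA t ⟨e, X e⟩

/-- A section `X` of `D → E` is a core section: `X(e) = 0_e +_A c̄(m)` for `e ∈ E_m`, for a smooth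
section `c` of the core. -/
def IsCoreSection (X : Cₛ^∞⟮𝓘(ℝ, EM).prod 𝓘(ℝ, FE); F₁, D₁⟯) : Prop :=
  ∃ c : (m : M) → 𝒟.Core m,
    ContMDiff 𝓘(ℝ, EM) ((𝓘(ℝ, EM).prod 𝓘(ℝ, FE)).prod 𝓘(ℝ, F₁)) ∞
      (fun m => 𝒟.coreIncl m (c m)) ∧
    ∀ e : TotalSpace FE E, 𝒟.SumA ⟨e, 0⟩ (𝒟.coreIncl e.proj (c e.proj)) ⟨e, X e⟩

/-- The smooth vector bundle structure on the core, of rank `k`, for which the inclusion into `D`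
is smooth. -/
class CoreBundle (k : ℕ) where
  topology : TopologicalSpace (TotalSpace (Fin k → ℝ) 𝒟.Core)
  fiberBundle : FiberBundle (Fin k → ℝ) 𝒟.Core
  vectorBundle : VectorBundle ℝ (Fin k → ℝ) 𝒟.Core
  contMDiffVectorBundle : ContMDiffVectorBundle ∞ (Fin k → ℝ) 𝒟.Core 𝓘(ℝ, EM)
  contMDiff_coreIncl : ContMDiff (𝓘(ℝ, EM).prod 𝓘(ℝ, Fin k → ℝ))
    ((𝓘(ℝ, EM).prod 𝓘(ℝ, FE)).prod 𝓘(ℝ, F₁)) ∞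
    (fun c : TotalSpace (Fin k → ℝ) 𝒟.Core => 𝒟.coreIncl c.proj c.snd)

attribute [reducible] CoreBundle.topology CoreBundle.fiberBundle

attribute [instance] CoreBundle.topology CoreBundle.fiberBundle CoreBundle.vectorBundle
  CoreBundle.contMDiffVectorBundle

variable (EM FE E) in
/-- The projection `p_E : E → M`, as a smooth map. -/
def projE : C^∞⟮𝓘(ℝ, EM).prod 𝓘(ℝ, FE), TotalSpace FE E; 𝓘(ℝ, EM), M⟯ :=
  ⟨TotalSpace.proj, contMDiff_proj E⟩

/-- `i` is the canonical map `p_E^* C → D`, `(e, c) ↦ 0_e +_A c̄`, and it is an isomorphism of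
vector bundles over `E` from `p_E^* C` onto the kernel of `p`: it is smooth, fibrewise linear and
injective, and its image is `ker p`. -/
structure IsKernelIso (k : ℕ) [𝒟.CoreBundle k]
    (i : (e : TotalSpace FE E) → ((projE EM FE E) *ᵖ 𝒟.Core) e →ₗ[ℝ] D₁ e) : Prop where
  apply_eq : ∀ (e : TotalSpace FE E) (c : 𝒟.Core e.proj),
    𝒟.SumA ⟨e, 0⟩ (𝒟.coreIncl e.proj c) ⟨e, i e c⟩
  contMDiff : ContMDiff ((𝓘(ℝ, EM).prod 𝓘(ℝ, FE)).prod 𝓘(ℝ, Fin k → ℝ))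
    ((𝓘(ℝ, EM).prod 𝓘(ℝ, FE)).prod 𝓘(ℝ, F₁)) ∞
    (fun x : TotalSpace (Fin k → ℝ) ((projE EM FE E) *ᵖ 𝒟.Core) =>
      (⟨x.proj, i x.proj x.snd⟩ : TotalSpace F₁ D₁))
  injective : ∀ e, Function.Injective (i e)
  range_eq : ∀ e, LinearMap.range (i e) = LinearMap.ker (𝒟.p e)

end DoubleVectorBundle

variable [IsManifold 𝓘(ℝ, EM) ∞ M] [ContMDiffVectorBundle ∞ FE E 𝓘(ℝ, EM)]

/-- The compatibility of Lie algebroid structures on `D → E` and on `A → M` which makes a double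
vector bundle a VB-algebroid. -/
structure IsVBAlgebroid (𝒟 : DoubleVectorBundle (EM := EM) FA A FE E F₁ D₁ F₂ D₂)
    (LD : LieAlgebroid (𝓘(ℝ, EM).prod 𝓘(ℝ, FE)) F₁ D₁) (LA : LieAlgebroid 𝓘(ℝ, EM) FA A) :
    Prop where
  /-- `ρ_D : D → TE` covers `ρ_A : A → TM`. -/
  anchor_covers : ∀ (e : TotalSpace FE E) (d : D₁ e),
    mfderiv (𝓘(ℝ, EM).prod 𝓘(ℝ, FE)) 𝓘(ℝ, EM) (TotalSpace.proj : TotalSpace FE E → M) e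
      (LD.anchor e d) = LA.anchor e.proj (𝒟.p e d)
  /-- `ρ_D` is additive from the fibres of `D → A` to those of `TE → TM`. -/
  anchor_add : ∀ d₁ d₂ d : TotalSpace F₁ D₁, 𝒟.SumA d₁ d₂ d →
    TangentSum (E := E) ⟨d₁.proj, LD.anchor d₁.proj d₁.snd⟩
      ⟨d₂.proj, LD.anchor d₂.proj d₂.snd⟩ ⟨d.proj, LD.anchor d.proj d.snd⟩
  /-- `ρ_D` is homogeneous from the fibres of `D → A` to those of `TE → TM`. -/
  anchor_smul : ∀ (t : ℝ) (d : TotalSpace F₁ D₁),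
    (⟨(𝒟.smulA t d).proj, LD.anchor (𝒟.smulA t d).proj (𝒟.smulA t d).snd⟩ :
      TangentBundle (𝓘(ℝ, EM).prod 𝓘(ℝ, FE)) (TotalSpace FE E)) =
    tangentMap (𝓘(ℝ, EM).prod 𝓘(ℝ, FE)) (𝓘(ℝ, EM).prod 𝓘(ℝ, FE)) (fibreSMul t)
      ⟨d.proj, LD.anchor d.proj d.snd⟩
  /-- The bracket of linear sections is linear, over the bracket of the sections of `A` that they
  cover. -/
  bracket_linear_linear : ∀ X Y a b, 𝒟.IsLinearSection X a → 𝒟.IsLinearSection Y b →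
    𝒟.IsLinearSection (LD.bracket X Y) (LA.bracket a b)
  bracket_linear_core : ∀ X Y a, 𝒟.IsLinearSection X a → 𝒟.IsCoreSection Y →
    𝒟.IsCoreSection (LD.bracket X Y)
  bracket_core_core : ∀ X Y, 𝒟.IsCoreSection X → 𝒟.IsCoreSection Y → LD.bracket X Y = 0

/-- An Ehresmann connection on `p : D → A` is linear if its horizontal lifts are linear
sections. -/
def DoubleVectorBundle.IsLinearConnection
    (𝒟 : DoubleVectorBundle (EM := EM) FA A FE E F₁ D₁ F₂ D₂)
    (h : EhresmannConnection (𝓘(ℝ, EM).prod 𝓘(ℝ, FE)) F₁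
      (TotalSpace.proj : TotalSpace FE E → M) 𝒟.p) : Prop :=
  ∀ (a : Cₛ^∞⟮𝓘(ℝ, EM); FA, A⟯), ∃ X : Cₛ^∞⟮𝓘(ℝ, EM).prod 𝓘(ℝ, FE); F₁, D₁⟯,
    h.IsHorizontalLift a X ∧ 𝒟.IsLinearSection X a

end VBAlgebroid

end

/-
The map `p` is onto: `p_D` is onto over the zero section of `A`, hence over a neighbourhood of it,
and homotheties reach the rest of `A`. A fibrewise surjective bundle morphism splits locally. Along
a section of `A`, splitting `p_D` yields local linear lifts to `D`; being linear is an affine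
condition, so a partition of unity glues them to a global linear lift, whose image is a linear
connection. Along the zero section of `E`, splitting `p` yields local frames of the core, and
`kernelIncl : (e, c) ↦ 0_e +_A c̄` carries them to frames of `ker p`.

Sections of `ker p` are therefore locally combinations of core sections, and the Leibniz rule shows
that their brackets with one another and with linear sections stay in `ker p`. Since linear sections
over `a` and `b` bracket to one over `[a, b]`, writing any section as a combination of horizontal
lifts plus a section of `ker p` proves that `p` is a Lie algebroid morphism.

The anchor of a linear section is invariant under the homotheties of `E`, so the existence time of
its integral curves is bounded below near each fibre as a whole. Over a compact piece of an integral
curve of `ρ(a)` the bound is uniform, so integral curves extend as long as those of `ρ(a)`.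
-/

/-! ### Total spaces of vector bundles -/

section TotalSpaceTopology

variable {B F : Type*} {V : B → Type*} [TopologicalSpace B] [TopologicalSpace F]
  [TopologicalSpace (TotalSpace F V)] [∀ b, TopologicalSpace (V b)] [FiberBundle F V]

theorem t2Space_totalSpace [T2Space B] [T2Space F] : T2Space (TotalSpace F V) := by
  refine ⟨fun x y hxy => ?_⟩
  by_cases h : x.proj = y.proj
  · let e := trivializationAt F V x.proj
    have hx : x ∈ e.source := FiberBundle.mem_trivializationAt_proj_source
    have hy : y ∈ e.source := by
      rw [e.mem_source, ← h]
      exact FiberBundle.mem_baseSet_trivializationAt F V x.proj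
    obtain ⟨u, v, hu, hv, hxu, hyv, huv⟩ := t2_separation (e.injOn.ne hx hy hxy)
    exact ⟨e.source ∩ e ⁻¹' u, e.source ∩ e ⁻¹' v,
      e.continuousOn.isOpen_inter_preimage e.open_source hu,
      e.continuousOn.isOpen_inter_preimage e.open_source hv, ⟨hx, hxu⟩, ⟨hy, hyv⟩,
      (huv.preimage e).mono Set.inter_subset_right Set.inter_subset_right⟩
  · exact separated_by_continuous (FiberBundle.continuous_proj F V) h

end TotalSpaceTopology

section Trivialization

variable {B : Type*} [TopologicalSpace B] {F : Type*} [NormedAddCommGroup F] [NormedSpace ℝ F]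
  {V : B → Type*} [TopologicalSpace (TotalSpace F V)]
  [∀ b, AddCommGroup (V b)] [∀ b, Module ℝ (V b)]

theorem trivialization_snd_add (e : Trivialization F (TotalSpace.proj : TotalSpace F V → B))
    [e.IsLinear ℝ] {b : B} (hb : b ∈ e.baseSet) (u v : V b) :
    (e ⟨b, u + v⟩).2 = (e ⟨b, u⟩).2 + (e ⟨b, v⟩).2 := (e.linear ℝ hb).map_add u v

theorem trivialization_snd_smul (e : Trivialization F (TotalSpace.proj : TotalSpace F V → B))
    [e.IsLinear ℝ] {b : B} (hb : b ∈ e.baseSet) (t : ℝ) (u : V b) :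
    (e ⟨b, t • u⟩).2 = t • (e ⟨b, u⟩).2 := (e.linear ℝ hb).map_smul t u

theorem linearMapAt_injective (e : Trivialization F (TotalSpace.proj : TotalSpace F V → B))
    [e.IsLinear ℝ] {b : B} (hb : b ∈ e.baseSet) : Function.Injective (e.linearMapAt ℝ b) := by
  rw [e.linearMapAt_def_of_mem hb]
  exact (e.linearEquivAt ℝ b hb).injective

variable [∀ b, TopologicalSpace (V b)] [FiberBundle F V] [VectorBundle ℝ F V]

theorem map_real_smul_of_continuous_totalSpace {b : B} (g : ℝ →+ V b)
    (hg : Continuous fun t => (⟨b, g t⟩ : TotalSpace F V)) (t : ℝ) : g t = t • g 1 := by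
  have hb := FiberBundle.mem_baseSet_trivializationAt F V b
  let e := trivializationAt F V b
  let g' : ℝ →+ F := (e.linearMapAt ℝ b).toAddMonoidHom.comp g
  have hg' : Continuous g' := by
    have h : Continuous fun t => e ⟨b, g t⟩ :=
      e.continuousOn.comp_continuous hg fun t => e.mem_source.2 hb
    refine (continuous_snd.comp h).congr fun t => ?_
    exact (congrFun (e.coe_linearMapAt_of_mem (R := ℝ) hb) (g t)).symm
  apply linearMapAt_injective e hb
  calc g' t = g' (t • 1) := by rw [smul_eq_mul, mul_one]
    _ = t • g' 1 := map_real_smul g' hg' t 1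
    _ = e.linearMapAt ℝ b (t • g 1) := ((e.linearMapAt ℝ b).map_smul t (g 1)).symm

end Trivialization

/-! ### Smoothness of the fibrewise operations -/

namespace FibreSum

variable {B F : Type*} {V : B → Type*} [∀ b, AddCommGroup (V b)]
  {x y z : TotalSpace F V}

theorem proj_left (h : FibreSum x y z) : x.proj = z.proj := by
  obtain ⟨b, u, v, rfl, rfl, rfl⟩ := h
  rfl

theorem proj_right (h : FibreSum x y z) : y.proj = z.proj := by
  obtain ⟨b, u, v, rfl, rfl, rfl⟩ := h
  rfl

theorem symm (h : FibreSum x y z) : FibreSum y x z := by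
  obtain ⟨b, u, v, rfl, rfl, rfl⟩ := h
  exact ⟨b, v, u, rfl, rfl, by rw [add_comm]⟩

theorem neg_right [∀ b, Module ℝ (V b)] (h : FibreSum x y z) :
    FibreSum z (fibreSMul (-1) y) x := by
  obtain ⟨b, u, v, rfl, rfl, rfl⟩ := h
  exact ⟨b, u + v, -v, rfl, by simp [fibreSMul], by simp⟩

end FibreSum

section SmoothFibrewise

variable {EB : Type*} [NormedAddCommGroup EB] [NormedSpace ℝ EB]
  {HB : Type*} [TopologicalSpace HB] {IB : ModelWithCorners ℝ EB HB}
  {B : Type*} [TopologicalSpace B] [ChartedSpace HB B]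
  {F : Type*} [NormedAddCommGroup F] [NormedSpace ℝ F]
  {V : B → Type*} [TopologicalSpace (TotalSpace F V)]
  [∀ b, AddCommGroup (V b)] [∀ b, Module ℝ (V b)] [∀ b, TopologicalSpace (V b)]
  [FiberBundle F V] [VectorBundle ℝ F V]
  {EQ : Type*} [NormedAddCommGroup EQ] [NormedSpace ℝ EQ]
  {HQ : Type*} [TopologicalSpace HQ] {IQ : ModelWithCorners ℝ EQ HQ}
  {Q : Type*} [TopologicalSpace Q] [ChartedSpace HQ Q] {f g h : Q → TotalSpace F V} {q₀ : Q}

theorem contMDiffAt_fibreSum (hf : ContMDiffAt IQ (IB.prod 𝓘(ℝ, F)) ∞ f q₀)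
    (hg : ContMDiffAt IQ (IB.prod 𝓘(ℝ, F)) ∞ g q₀) (hs : ∀ q, FibreSum (f q) (g q) (h q)) :
    ContMDiffAt IQ (IB.prod 𝓘(ℝ, F)) ∞ h q₀ := by
  let e := trivializationAt F V (h q₀).proj
  rw [contMDiffAt_totalSpace] at hf hg ⊢
  have hproj : ContMDiffAt IQ IB ∞ (fun q => (h q).proj) q₀ := by
    simpa only [(hs _).proj_left] using hf.1
  have hmem : ∀ᶠ q in 𝓝 q₀, (h q).proj ∈ e.baseSet := hproj.continuousAt.preimage_mem_nhds
    (e.open_baseSet.mem_nhds (FiberBundle.mem_baseSet_trivializationAt F V _))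
  have hfe : ContMDiffAt IQ 𝓘(ℝ, F) ∞ (fun q => (e (f q)).2) q₀ := by
    simpa only [(hs q₀).proj_left] using hf.2
  have hge : ContMDiffAt IQ 𝓘(ℝ, F) ∞ (fun q => (e (g q)).2) q₀ := by
    simpa only [(hs q₀).proj_right] using hg.2
  refine ⟨hproj, (hfe.add hge).congr_of_eventuallyEq (hmem.mono fun q hq => ?_)⟩
  obtain ⟨b, u, v, hu, hv, huv⟩ := hs q
  rw [huv] at hq
  simp only [Pi.add_apply, hu, hv, huv]
  exact trivialization_snd_add e hq u v

theorem contMDiffAt_fibreSMul {t : Q → ℝ} (ht : ContMDiffAt IQ 𝓘(ℝ, ℝ) ∞ t q₀)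
    (hf : ContMDiffAt IQ (IB.prod 𝓘(ℝ, F)) ∞ f q₀) :
    ContMDiffAt IQ (IB.prod 𝓘(ℝ, F)) ∞ (fun q => fibreSMul (t q) (f q)) q₀ := by
  let e := trivializationAt F V (f q₀).proj
  rw [contMDiffAt_totalSpace] at hf ⊢
  have hmem : ∀ᶠ q in 𝓝 q₀, (f q).proj ∈ e.baseSet := hf.1.continuousAt.preimage_mem_nhds
    (e.open_baseSet.mem_nhds (FiberBundle.mem_baseSet_trivializationAt F V _))
  refine ⟨hf.1, (ht.smul hf.2).congr_of_eventuallyEq (hmem.mono fun q hq => ?_)⟩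
  exact trivialization_snd_smul e hq (t q) (f q).snd

theorem contMDiff_fibreSMul (t : ℝ) : ContMDiff (IB.prod 𝓘(ℝ, F)) (IB.prod 𝓘(ℝ, F)) ∞
    (fibreSMul t : TotalSpace F V → TotalSpace F V) := fun _ =>
  contMDiffAt_fibreSMul contMDiffAt_const contMDiffAt_id

theorem contMDiff_fibreSMul_left (x : TotalSpace F V) :
    ContMDiff 𝓘(ℝ, ℝ) (IB.prod 𝓘(ℝ, F)) ∞ fun t : ℝ => fibreSMul t x := fun _ =>
  contMDiffAt_fibreSMul contMDiffAt_id contMDiffAt_const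

theorem contMDiffAt_of_fibreSum (hh : ContMDiffAt IQ (IB.prod 𝓘(ℝ, F)) ∞ h q₀)
    (hg : ContMDiffAt IQ (IB.prod 𝓘(ℝ, F)) ∞ g q₀) (hs : ∀ q, FibreSum (f q) (g q) (h q)) :
    ContMDiffAt IQ (IB.prod 𝓘(ℝ, F)) ∞ f q₀ :=
  contMDiffAt_fibreSum hh (contMDiffAt_fibreSMul contMDiffAt_const hg) fun q => (hs q).neg_right

theorem contMDiffAt_fibreSMul_of_mem_tsupport {ψ : Q → ℝ} (hψ : ContMDiffAt IQ 𝓘(ℝ) ∞ ψ q₀)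
    (hproj : ContMDiffAt IQ IB ∞ (fun q => (f q).proj) q₀)
    (hf : q₀ ∈ tsupport ψ → ContMDiffAt IQ (IB.prod 𝓘(ℝ, F)) ∞ f q₀) :
    ContMDiffAt IQ (IB.prod 𝓘(ℝ, F)) ∞ (fun q => fibreSMul (ψ q) (f q)) q₀ := by
  by_cases hq₀ : q₀ ∈ tsupport ψ
  · exact contMDiffAt_fibreSMul hψ (hf hq₀)
  · refine ((contMDiff_zeroSection ℝ V).contMDiffAt.comp q₀ hproj).congr_of_eventuallyEq ?_
    filter_upwards [(isClosed_tsupport ψ).isOpen_compl.mem_nhds hq₀] with q hq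
    rw [fibreSMul, image_eq_zero_of_notMem_tsupport hq, zero_smul]
    rfl

end SmoothFibrewise

section TrivializationSmooth

variable {EB : Type*} [NormedAddCommGroup EB] [NormedSpace ℝ EB]
  {HB : Type*} [TopologicalSpace HB] {IB : ModelWithCorners ℝ EB HB}
  {B : Type*} [TopologicalSpace B] [ChartedSpace HB B]
  {F : Type*} [NormedAddCommGroup F] [NormedSpace ℝ F]
  {V : B → Type*} [TopologicalSpace (TotalSpace F V)]
  [∀ b, AddCommGroup (V b)] [∀ b, Module ℝ (V b)] [∀ b, TopologicalSpace (V b)]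
  [FiberBundle F V] [VectorBundle ℝ F V] [ContMDiffVectorBundle ∞ F V IB]
  {EQ : Type*} [NormedAddCommGroup EQ] [NormedSpace ℝ EQ]
  {HQ : Type*} [TopologicalSpace HQ] {IQ : ModelWithCorners ℝ EQ HQ}
  {Q : Type*} [TopologicalSpace Q] [ChartedSpace HQ Q] {g : Q → B} {q₀ : Q}
  (e : Trivialization F (TotalSpace.proj : TotalSpace F V → B)) [MemTrivializationAtlas e]

theorem contMDiffAt_symmₗ (hq₀ : g q₀ ∈ e.baseSet) {v : Q → F}
    (hg : ContMDiffAt IQ IB ∞ g q₀) (hv : ContMDiffAt IQ 𝓘(ℝ, F) ∞ v q₀) :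
    ContMDiffAt IQ (IB.prod 𝓘(ℝ, F)) ∞
      (fun q => (⟨g q, e.symmₗ ℝ (g q) (v q)⟩ : TotalSpace F V)) q₀ := by
  rw [e.contMDiffAt_iff (e.mem_source.2 hq₀)]
  refine ⟨hg, hv.congr_of_eventuallyEq ?_⟩
  filter_upwards [hg.continuousAt.preimage_mem_nhds (e.open_baseSet.mem_nhds hq₀)] with q hq
  rw [e.symmₗ_apply (Set.mem_preimage.1 hq), e.apply_mk_symm (Set.mem_preimage.1 hq)]

theorem contMDiffAt_linearMapAt {x : Q → TotalSpace F V} (hq₀ : (x q₀).proj ∈ e.baseSet)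
    (hx : ContMDiffAt IQ (IB.prod 𝓘(ℝ, F)) ∞ x q₀) :
    ContMDiffAt IQ 𝓘(ℝ, F) ∞ (fun q => e.linearMapAt ℝ (x q).proj (x q).snd) q₀ := by
  obtain ⟨hproj, hsnd⟩ := (e.contMDiffAt_iff (e.mem_source.2 hq₀)).1 hx
  refine hsnd.congr_of_eventuallyEq ?_
  filter_upwards [hproj.continuousAt.preimage_mem_nhds (e.open_baseSet.mem_nhds hq₀)] with q hq
  rw [e.coe_linearMapAt_of_mem (Set.mem_preimage.1 hq)]

end TrivializationSmooth

section Projection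

variable {EB : Type*} [NormedAddCommGroup EB] [NormedSpace ℝ EB]
  {HB : Type*} [TopologicalSpace HB] {IB : ModelWithCorners ℝ EB HB}
  {B : Type*} [TopologicalSpace B] [ChartedSpace HB B]
  {F : Type*} [NormedAddCommGroup F] [NormedSpace ℝ F]
  {V : B → Type*} [TopologicalSpace (TotalSpace F V)]
  [∀ b, AddCommGroup (V b)] [∀ b, TopologicalSpace (V b)] [FiberBundle F V]

section Pullback

variable {EB' : Type*} [NormedAddCommGroup EB'] [NormedSpace ℝ EB']
  {HB' : Type*} [TopologicalSpace HB'] {IB' : ModelWithCorners ℝ EB' HB'}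
  {B' : Type*} [TopologicalSpace B'] [ChartedSpace HB' B']

theorem contMDiff_pullback_lift (f : C^∞⟮IB', B'; IB, B⟯) :
    ContMDiff (IB'.prod 𝓘(ℝ, F)) (IB.prod 𝓘(ℝ, F)) ∞
      (Pullback.lift f : TotalSpace F (f *ᵖ V) → TotalSpace F V) := by
  intro x
  have hid := contMDiffAt_totalSpace.1 (contMDiffAt_id (I := IB'.prod 𝓘(ℝ, F)) (n := ∞) (x := x))
  rw [contMDiffAt_totalSpace]
  exact ⟨f.contMDiff.contMDiffAt.comp x hid.1, hid.2⟩

end Pullback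

variable [∀ b, Module ℝ (V b)] [VectorBundle ℝ F V]

theorem isSubmersion_totalSpace_proj [IsManifold IB ∞ B] [ContMDiffVectorBundle ∞ F V IB] :
    IsSubmersion (IB.prod 𝓘(ℝ, F)) IB ∞ (TotalSpace.proj : TotalSpace F V → B) := by
  refine IsSubmersionOfComplement.isSubmersion (F := F) fun x => ?_
  refine IsSubmersionAtOfComplement.mk_of_continuousAt
    (FiberBundle.continuous_proj F V).continuousAt (ContinuousLinearEquiv.refl ℝ (EB × F))
    (chartAt _ x) (chartAt _ x.proj) (mem_chart_source _ _) (mem_chart_source _ _)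
    (IsManifold.chart_mem_maximalAtlas x) (IsManifold.chart_mem_maximalAtlas x.proj) ?_
  intro y hy
  change (extChartAt IB x.proj) ((extChartAt (IB.prod 𝓘(ℝ, F)) x).symm y).proj = y.1
  change y ∈ (extChartAt (IB.prod 𝓘(ℝ, F)) x).target at hy
  rw [FiberBundle.extChartAt_target] at hy
  have hproj : ((extChartAt (IB.prod 𝓘(ℝ, F)) x).symm y).proj =
      (extChartAt IB x.proj).symm y.1 := by
    rw [FiberBundle.extChartAt]
    exact (trivializationAt F V x.proj).proj_symm_apply
      ((trivializationAt F V x.proj).mem_target.2 hy.1.2)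
  rw [hproj]
  exact (extChartAt IB x.proj).right_inv hy.1.1

end Projection

/-! ### Subbundles along a map -/

section ClmApply

variable {EN : Type*} [NormedAddCommGroup EN] [NormedSpace ℝ EN]
  {HN : Type*} [TopologicalSpace HN] {IN : ModelWithCorners ℝ EN HN}
  {N : Type*} [TopologicalSpace N] [ChartedSpace HN N]
  {F' : Type*} [NormedAddCommGroup F'] [NormedSpace ℝ F']
  {F : Type*} [NormedAddCommGroup F] [NormedSpace ℝ F] [FiniteDimensional ℝ F]

theorem contMDiffOn_clm_of_apply {P : N → F →L[ℝ] F'} {U : Set N}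
    (hP : ∀ v, ContMDiffOn IN 𝓘(ℝ, F') ∞ (fun n => P n v) U) :
    ContMDiffOn IN 𝓘(ℝ, F →L[ℝ] F') ∞ P U := by
  let e : F ≃L[ℝ] (Fin (Module.finrank ℝ F) → ℝ) :=
    ContinuousLinearEquiv.ofFinrankEq (Module.finrank_fin_fun ℝ).symm
  let coords : (F →L[ℝ] F') ≃L[ℝ] (Fin (Module.finrank ℝ F) → F') :=
    (e.arrowCongr (.refl ℝ F')).trans (ContinuousLinearEquiv.piRing _)
  have hcoords : ContMDiffOn IN 𝓘(ℝ, Fin (Module.finrank ℝ F) → F') ∞ (fun n => coords (P n)) U :=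
    contMDiffOn_pi_space.2 fun _ => hP _
  refine (coords.symm.contDiff.contMDiff.comp_contMDiffOn hcoords).congr fun n _ => ?_
  exact (coords.symm_apply_apply (P n)).symm

end ClmApply

section Subbundle

variable {EB : Type*} [NormedAddCommGroup EB] [NormedSpace ℝ EB]
  {HB : Type*} [TopologicalSpace HB] {IB : ModelWithCorners ℝ EB HB}
  {B : Type*} [TopologicalSpace B] [ChartedSpace HB B]
  {F : Type*} [NormedAddCommGroup F] [NormedSpace ℝ F]
  {V : B → Type*} [TopologicalSpace (TotalSpace F V)]
  [∀ b, AddCommGroup (V b)] [∀ b, Module ℝ (V b)] [∀ b, TopologicalSpace (V b)]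
  [FiberBundle F V]
  {EN : Type*} [NormedAddCommGroup EN] [NormedSpace ℝ EN]
  {HN : Type*} [TopologicalSpace HN] {IN : ModelWithCorners ℝ EN HN}
  {N : Type*} [TopologicalSpace N] [ChartedSpace HN N]
  {z : N → B} {S : (n : N) → Submodule ℝ (V (z n))} {k : ℕ}

variable (IB F V IN z S k) in
/-- A local trivialization of rank `k` of a family `S` of subspaces of the pullback `z^*V`, used to
make `S` a vector bundle over `N`. The coordinates are defined on all of `V`, so that smoothness can
be tested there before `S` has a smooth structure. -/
structure SubbundleChart where
  source : Set N
  isOpen_source : IsOpen source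
  coord : (b : B) → V b →ₗ[ℝ] (Fin k → ℝ)
  frame : (n : N) → (Fin k → ℝ) →ₗ[ℝ] S n
  coord_frame : ∀ n ∈ source, ∀ c, coord (z n) (frame n c) = c
  frame_coord : ∀ n ∈ source, ∀ v : S n, frame n (coord (z n) v) = v
  contMDiffAt_coord : ∀ n ∈ source, ∀ v : V (z n),
    ContMDiffAt (IB.prod 𝓘(ℝ, F)) 𝓘(ℝ, Fin k → ℝ) ∞
      (fun x : TotalSpace F V => coord x.proj x.snd) ⟨z n, v⟩
  contMDiffOn_frame : ContMDiffOn (IN.prod 𝓘(ℝ, Fin k → ℝ)) (IB.prod 𝓘(ℝ, F)) ∞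
    (fun x : N × (Fin k → ℝ) => (⟨z x.1, frame x.1 x.2⟩ : TotalSpace F V)) (source ×ˢ Set.univ)

namespace SubbundleChart

variable {EQ : Type*} [NormedAddCommGroup EQ] [NormedSpace ℝ EQ]
  {HQ : Type*} [TopologicalSpace HQ] {IQ : ModelWithCorners ℝ EQ HQ}
  {Q : Type*} [TopologicalSpace Q] [ChartedSpace HQ Q]
  (φ ψ : SubbundleChart IB F V IN z S k) {n : N}

theorem sum_coord_smul_frame (hn : n ∈ φ.source) (v : S n) :
    ∑ l, φ.coord (z n) v l • φ.frame n (Pi.basisFun ℝ _ l) = v := by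
  simp_rw [← map_smul, ← map_sum]
  exact (congrArg (φ.frame n) ((Pi.basisFun ℝ _).sum_repr _)).trans (φ.frame_coord n hn v)

theorem continuous_coord (hn : n ∈ φ.source) :
    Continuous fun v : S n => φ.coord (z n) (v : V (z n)) := by
  have hcoord : Continuous fun v : V (z n) => φ.coord (z n) v :=
    continuous_iff_continuousAt.2 fun v =>
      ContinuousAt.comp (f := TotalSpace.mk (z n)) (φ.contMDiffAt_coord n hn v).continuousAt
        (FiberBundle.continuous_totalSpaceMk F V (z n)).continuousAt
  exact hcoord.comp continuous_subtype_val

theorem continuous_frame (hn : n ∈ φ.source) : Continuous (φ.frame n) := by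
  rw [continuous_induced_rng, (FiberBundle.totalSpaceMk_isInducing F V (z n)).continuous_iff]
  exact φ.contMDiffOn_frame.continuousOn.comp_continuous (Continuous.prodMk_right n)
    fun _ => ⟨hn, Set.mem_univ _⟩

theorem contMDiffOn_frame_const (c : Fin k → ℝ) : ContMDiffOn IN (IB.prod 𝓘(ℝ, F)) ∞
    (fun n => (⟨z n, φ.frame n c⟩ : TotalSpace F V)) φ.source :=
  φ.contMDiffOn_frame.comp (contMDiffOn_id.prodMk contMDiffOn_const)
    fun _ hn => ⟨hn, Set.mem_univ c⟩

theorem contMDiff_smul_frame [VectorBundle ℝ F V] (hz : ContMDiff IN IB ∞ z) {χ : N → ℝ}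
    (hχ : ContMDiff IN 𝓘(ℝ) ∞ χ) (hφχ : tsupport χ ⊆ φ.source) (c : Fin k → ℝ) :
    ContMDiff IN (IB.prod 𝓘(ℝ, F)) ∞
      fun n => (⟨z n, (χ n • φ.frame n c : S n)⟩ : TotalSpace F V) := fun n =>
  contMDiffAt_fibreSMul_of_mem_tsupport
    (f := fun n => (⟨z n, φ.frame n c⟩ : TotalSpace F V)) (hχ n) (hz n) fun hn =>
      (φ.contMDiffOn_frame_const c).contMDiffAt (φ.isOpen_source.mem_nhds (hφχ hn))

theorem contMDiff_mul_coord {r : Q → N} (hr : ContMDiff IQ IN ∞ r) {χ : N → ℝ}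
    (hχ : ContMDiff IN 𝓘(ℝ) ∞ χ) (hφχ : tsupport χ ⊆ φ.source) {v : (q : Q) → V (z (r q))}
    (hv : ContMDiff IQ (IB.prod 𝓘(ℝ, F)) ∞ fun q => (⟨z (r q), v q⟩ : TotalSpace F V))
    (l : Fin k) : ContMDiff IQ 𝓘(ℝ) ∞ fun q => χ (r q) * φ.coord (z (r q)) (v q) l := by
  refine contMDiff_of_tsupport fun q hq => ?_
  have hmem : r q ∈ φ.source := hφχ <|
    tsupport_comp_subset_preimage χ hr.continuous (tsupport_mul_subset_left hq)
  have hcoord := (φ.contMDiffAt_coord (r q) hmem (v q)).comp q (hv q)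
  exact (hχ.contMDiffAt.comp q (hr q)).mul (contMDiffAt_pi_space.1 hcoord l)

/-- The coordinate change from `φ` to `ψ`. -/
noncomputable def coordChange (n : N) : (Fin k → ℝ) →L[ℝ] (Fin k → ℝ) :=
  (ψ.coord (z n) ∘ₗ (S n).subtype ∘ₗ φ.frame n).toContinuousLinearMap

theorem contMDiffOn_coordChange : ContMDiffOn IN 𝓘(ℝ, (Fin k → ℝ) →L[ℝ] (Fin k → ℝ)) ∞
    (φ.coordChange ψ) (φ.source ∩ ψ.source) :=
  contMDiffOn_clm_of_apply fun c n hn => (ψ.contMDiffAt_coord n hn.2 _).comp_contMDiffWithinAt n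
    ((φ.contMDiffOn_frame_const c n hn.1).mono Set.inter_subset_left)

/-- The local trivialization of the total space of `S` defined by the chart. -/
def pretrivialization : Pretrivialization (Fin k → ℝ)
    (TotalSpace.proj : TotalSpace (Fin k → ℝ) (fun n => S n) → N) where
  toFun v := (v.proj, φ.coord (z v.proj) v.snd)
  invFun x := ⟨x.1, φ.frame x.1 x.2⟩
  source := TotalSpace.proj ⁻¹' φ.source
  target := φ.source ×ˢ Set.univ
  map_source' _ hv := ⟨hv, Set.mem_univ _⟩
  map_target' _ hx := hx.1
  left_inv' v hv := congrArg (TotalSpace.mk v.proj) (φ.frame_coord _ hv v.snd)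
  right_inv' x hx := congrArg (Prod.mk x.1) (φ.coord_frame _ hx.1 x.2)
  open_target := φ.isOpen_source.prod isOpen_univ
  baseSet := φ.source
  open_baseSet := φ.isOpen_source
  source_eq := rfl
  target_eq := rfl
  proj_toFun _ _ := rfl

theorem coordChange_apply (hn : n ∈ φ.source) (c : Fin k → ℝ) :
    φ.coordChange ψ n c = (ψ.pretrivialization ⟨n, φ.pretrivialization.symm n c⟩).2 := by
  have hsymm : φ.pretrivialization.symm n c = φ.frame n c :=
    (TotalSpace.mk_inj (E := fun n => S n)).1 (φ.pretrivialization.mk_symm hn c)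
  rw [hsymm]
  rfl

theorem isInducing_pretrivialization (hn : n ∈ φ.source) :
    Topology.IsInducing (φ.pretrivialization ∘ TotalSpace.mk n) := by
  have hid : (φ.frame n ∘ Prod.snd) ∘ (φ.pretrivialization ∘ TotalSpace.mk n) = id :=
    funext fun v => φ.frame_coord n hn v
  refine .of_comp (continuous_const.prodMk (φ.continuous_coord hn))
    ((φ.continuous_frame hn).comp continuous_snd) ?_
  rw [hid]
  exact .id

end SubbundleChart

variable (h : ∀ n, ∃ φ : SubbundleChart IB F V IN z S k, n ∈ φ.source)

/-- The vector bundle structure on a family of subspaces which has charts everywhere. -/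
noncomputable def subbundlePrebundle : VectorPrebundle ℝ (Fin k → ℝ) (fun n => S n) where
  pretrivializationAtlas :=
    Set.range fun φ : SubbundleChart IB F V IN z S k => φ.pretrivialization
  pretrivialization_linear' := by
    rintro _ ⟨φ, rfl⟩
    exact ⟨fun n _ => ((φ.coord (z n)) ∘ₗ (S n).subtype).isLinear⟩
  pretrivializationAt n := (h n).choose.pretrivialization
  mem_base_pretrivializationAt n := (h n).choose_spec
  pretrivialization_mem_atlas n := ⟨_, rfl⟩
  exists_coordChange := by
    rintro _ ⟨φ, rfl⟩ _ ⟨ψ, rfl⟩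
    exact ⟨φ.coordChange ψ, (φ.contMDiffOn_coordChange ψ).continuousOn,
      fun n hn => φ.coordChange_apply ψ hn.1⟩
  totalSpaceMk_isInducing n := (h n).choose.isInducing_pretrivialization (h n).choose_spec

instance isContMDiff_subbundlePrebundle : (subbundlePrebundle h).IsContMDiff IN ∞ where
  exists_contMDiffCoordChange := by
    rintro _ ⟨φ, rfl⟩ _ ⟨ψ, rfl⟩
    exact ⟨φ.coordChange ψ, φ.contMDiffOn_coordChange ψ,
      fun n hn => φ.coordChange_apply ψ hn.1⟩

theorem contMDiff_subbundlePrebundle_incl :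
    letI := (subbundlePrebundle h).totalSpaceTopology
    letI := (subbundlePrebundle h).toFiberBundle
    ContMDiff (IN.prod 𝓘(ℝ, Fin k → ℝ)) (IB.prod 𝓘(ℝ, F)) ∞
      fun v : TotalSpace (Fin k → ℝ) (fun n => S n) =>
        (⟨z v.proj, (v.snd : V (z v.proj))⟩ : TotalSpace F V) := fun v => by
  let := (subbundlePrebundle h).totalSpaceTopology
  let := (subbundlePrebundle h).toFiberBundle
  have := (subbundlePrebundle h).toVectorBundle
  have : ContMDiffVectorBundle ∞ (Fin k → ℝ) (fun n => S n) IN :=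
    (subbundlePrebundle h).contMDiffVectorBundle IN
  obtain ⟨φ, hφ⟩ := h v.proj
  let e := (subbundlePrebundle h).trivializationOfMemPretrivializationAtlas ⟨φ, rfl⟩
  have : MemTrivializationAtlas e := ⟨⟨_, ⟨φ, rfl⟩, rfl⟩⟩
  have hframe := φ.contMDiffOn_frame.comp (e.contMDiffOn (n := ∞) (IB := IN))
    fun _ hv => ⟨hv, Set.mem_univ _⟩
  refine (hframe.congr fun v hv => ?_).contMDiffAt (e.open_source.mem_nhds hφ)
  exact congrArg (fun s : S v.proj => TotalSpace.mk (F := F) (z v.proj) (s : V (z v.proj)))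
    (φ.frame_coord _ hv v.snd).symm

theorem isSmoothSubbundle_of_subbundleChart {S : (b : B) → Submodule ℝ (V b)}
    (h : ∀ b, ∃ φ : SubbundleChart IB F V IB id S k, b ∈ φ.source) : IsSmoothSubbundle IB F S := by
  intro b₀
  obtain ⟨φ, hφ⟩ := h b₀
  refine ⟨φ.source, φ.isOpen_source, hφ, k,
    fun i b => (S b).subtype (φ.frame b (Pi.basisFun ℝ _ i)),
    fun i => φ.contMDiffOn_frame_const _, fun b hb => ⟨?_, ?_⟩⟩
  · have hinj : Function.Injective ((S b).subtype ∘ₗ φ.frame b) :=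
      Function.LeftInverse.injective (g := φ.coord b) (φ.coord_frame b hb)
    exact (Pi.basisFun ℝ (Fin k)).linearIndependent.map' _ (LinearMap.ker_eq_bot.2 hinj)
  · have hframe : LinearMap.range (φ.frame b) = ⊤ :=
      LinearMap.range_eq_top.2 fun v => ⟨φ.coord b v.1, φ.frame_coord b hb v⟩
    calc Submodule.span ℝ (Set.range fun i => (S b).subtype (φ.frame b (Pi.basisFun ℝ _ i)))
      _ = (⊤ : Submodule ℝ (Fin k → ℝ)).map ((S b).subtype ∘ₗ φ.frame b) := by
        rw [← (Pi.basisFun ℝ (Fin k)).span_eq, Submodule.map_span, ← Set.range_comp]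
        rfl
      _ = S b := by
        rw [Submodule.map_comp, Submodule.map_top, hframe, Submodule.map_subtype_top]

end Subbundle

/-! ### Local splittings of vector bundle morphisms -/

theorem exists_isInvertible_prod_of_surjective {F F' : Type*} [NormedAddCommGroup F]
    [NormedSpace ℝ F] [FiniteDimensional ℝ F] [NormedAddCommGroup F'] [NormedSpace ℝ F']
    [FiniteDimensional ℝ F'] (P : F →L[ℝ] F') (hP : Function.Surjective P) :
    ∃ q : F →L[ℝ] (Fin (Module.finrank ℝ F - Module.finrank ℝ F') → ℝ),
      (P.prod q).IsInvertible := by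
  have hrank := LinearMap.finrank_range_add_finrank_ker P.toLinearMap
  rw [LinearMap.range_eq_top.2 hP, finrank_top] at hrank
  obtain ⟨r, hr⟩ := LinearMap.exists_leftInverse_of_injective
    (LinearMap.ker P.toLinearMap).subtype (Submodule.ker_subtype _)
  let j : LinearMap.ker P.toLinearMap ≃ₗ[ℝ]
      (Fin (Module.finrank ℝ F - Module.finrank ℝ F') → ℝ) :=
    LinearEquiv.ofFinrankEq _ _ (by rw [Module.finrank_fin_fun]; omega)
  let q := (j.toLinearMap ∘ₗ r).toContinuousLinearMap
  have hinj : Function.Injective (P.prod q).toLinearMap := by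
    rw [← LinearMap.ker_eq_bot, LinearMap.ker_eq_bot']
    intro v hv
    have hPv : P v = 0 := congrArg Prod.fst hv
    have hrv : r v = 0 := j.injective ((congrArg Prod.snd hv).trans (map_zero j).symm)
    have hv' := LinearMap.congr_fun hr ⟨v, hPv⟩
    rw [LinearMap.comp_apply, Submodule.subtype_apply, hrv] at hv'
    exact (congrArg Subtype.val hv').symm
  have hdim : Module.finrank ℝ F =
      Module.finrank ℝ (F' × (Fin (Module.finrank ℝ F - Module.finrank ℝ F') → ℝ)) := by
    rw [Module.finrank_prod, Module.finrank_fin_fun]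
    omega
  exact ⟨q, (LinearEquiv.ofInjectiveOfFinrankEq _ hinj hdim).toContinuousLinearEquiv,
    by ext <;> rfl⟩

section LocalSplitting

variable {EB : Type*} [NormedAddCommGroup EB] [NormedSpace ℝ EB]
  {HB : Type*} [TopologicalSpace HB] {IB : ModelWithCorners ℝ EB HB}
  {B : Type*} [TopologicalSpace B] [ChartedSpace HB B]
  {F : Type*} [NormedAddCommGroup F] [NormedSpace ℝ F]
  {V : B → Type*} [TopologicalSpace (TotalSpace F V)]
  [∀ b, AddCommGroup (V b)] [∀ b, Module ℝ (V b)] [∀ b, TopologicalSpace (V b)]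
  [FiberBundle F V] [VectorBundle ℝ F V]
  {EB' : Type*} [NormedAddCommGroup EB'] [NormedSpace ℝ EB']
  {HB' : Type*} [TopologicalSpace HB'] {IB' : ModelWithCorners ℝ EB' HB'}
  {B' : Type*} [TopologicalSpace B'] [ChartedSpace HB' B']
  {F' : Type*} [NormedAddCommGroup F'] [NormedSpace ℝ F']
  {W : B' → Type*} [TopologicalSpace (TotalSpace F' W)]
  [∀ b, AddCommGroup (W b)] [∀ b, Module ℝ (W b)] [∀ b, TopologicalSpace (W b)]
  [FiberBundle F' W]
  {EN : Type*} [NormedAddCommGroup EN] [NormedSpace ℝ EN]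
  {HN : Type*} [TopologicalSpace HN] {IN : ModelWithCorners ℝ EN HN}
  {N : Type*} [TopologicalSpace N] [ChartedSpace HN N]
  {f : B → B'} {Φ : (b : B) → V b →ₗ[ℝ] W (f b)} {z : N → B}

theorem continuous_base_of_bundleMap (hΦ : ContMDiff (IB.prod 𝓘(ℝ, F)) (IB'.prod 𝓘(ℝ, F')) ∞
    fun x : TotalSpace F V => (⟨f x.proj, Φ x.proj x.snd⟩ : TotalSpace F' W)) : Continuous f :=
  (FiberBundle.continuous_proj F' W).comp (hΦ.continuous.comp
    (contMDiff_zeroSection (n := ∞) (IB := IB) ℝ V).continuous)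

variable [VectorBundle ℝ F' W] [FiniteDimensional ℝ F]

/-- The coordinate expression of the vector bundle morphism `Φ` at `b` in the trivializations `eV`
and `eW`. -/
noncomputable def localRepr (Φ : (b : B) → V b →ₗ[ℝ] W (f b))
    (eV : Trivialization F (TotalSpace.proj : TotalSpace F V → B)) [MemTrivializationAtlas eV]
    (eW : Trivialization F' (TotalSpace.proj : TotalSpace F' W → B')) [MemTrivializationAtlas eW]
    (b : B) : F →L[ℝ] F' :=
  LinearMap.toContinuousLinearMap (eW.linearMapAt ℝ (f b) ∘ₗ Φ b ∘ₗ eV.symmₗ ℝ b)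

variable (IN Φ z) in
/-- A smooth splitting of the pullback `z^*V` as `z^*f^*W ⊕ ℝᵏ` over the open set `source`, for a
vector bundle morphism `Φ : V → W` over `f`. It is given in the trivializations `eV` and `eW`: the
coordinate expression of `Φ` together with the constant map `q` is invertible. -/
structure LocalSplitting
    (eV : Trivialization F (TotalSpace.proj : TotalSpace F V → B)) [MemTrivializationAtlas eV]
    (eW : Trivialization F' (TotalSpace.proj : TotalSpace F' W → B')) [MemTrivializationAtlas eW]
    (k : ℕ) where
  source : Set N
  isOpen_source : IsOpen source
  mem_baseSet : ∀ n ∈ source, z n ∈ eV.baseSet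
  map_mem_baseSet : ∀ n ∈ source, f (z n) ∈ eW.baseSet
  q : F →L[ℝ] (Fin k → ℝ)
  isInvertible : ∀ n ∈ source, ((localRepr Φ eV eW (z n)).prod q).IsInvertible
  contMDiffOn_inverse : ContMDiffOn IN 𝓘(ℝ, (F' × (Fin k → ℝ)) →L[ℝ] F) ∞
    (fun n => ((localRepr Φ eV eW (z n)).prod q).inverse) source

variable {eV : Trivialization F (TotalSpace.proj : TotalSpace F V → B)} [MemTrivializationAtlas eV]
  {eW : Trivialization F' (TotalSpace.proj : TotalSpace F' W → B')} [MemTrivializationAtlas eW]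
  {k : ℕ}

theorem localRepr_linearMapAt {b : B} (hb : b ∈ eV.baseSet) (v : V b) :
    localRepr Φ eV eW b (eV.linearMapAt ℝ b v) = eW.linearMapAt ℝ (f b) (Φ b v) := by
  change eW.linearMapAt ℝ (f b) (Φ b (eV.symmₗ ℝ b (eV.linearMapAt ℝ b v))) = _
  rw [eV.symmₗ_linearMapAt hb]

theorem localRepr_surjective {b : B} (hb : b ∈ eV.baseSet) (hfb : f b ∈ eW.baseSet)
    (hΦ : Function.Surjective (Φ b)) : Function.Surjective (localRepr Φ eV eW b) := fun w => by
  obtain ⟨v, hv⟩ := hΦ (eW.symmₗ ℝ (f b) w)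
  exact ⟨eV.linearMapAt ℝ b v, by
    rw [localRepr_linearMapAt hb, hv, eW.linearMapAt_symmₗ hfb]⟩

theorem contMDiffOn_localRepr [ContMDiffVectorBundle ∞ F V IB] [ContMDiffVectorBundle ∞ F' W IB']
    (hΦ : ContMDiff (IB.prod 𝓘(ℝ, F)) (IB'.prod 𝓘(ℝ, F')) ∞
      fun x : TotalSpace F V => (⟨f x.proj, Φ x.proj x.snd⟩ : TotalSpace F' W)) {U : Set N}
    (hU : IsOpen U) (hz : ContMDiffOn IN IB ∞ z U)
    (hUV : ∀ n ∈ U, z n ∈ eV.baseSet) (hUW : ∀ n ∈ U, f (z n) ∈ eW.baseSet) :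
    ContMDiffOn IN 𝓘(ℝ, F →L[ℝ] F') ∞ (fun n => localRepr Φ eV eW (z n)) U :=
  contMDiffOn_clm_of_apply fun v n hn =>
    have hsymm := contMDiffAt_symmₗ eV (hUV n hn) (hz.contMDiffAt (hU.mem_nhds hn))
      (contMDiffAt_const (c := v))
    (contMDiffAt_linearMapAt eW (hUW n hn) (hΦ.contMDiffAt.comp n hsymm)).contMDiffWithinAt

theorem exists_localSplitting [FiniteDimensional ℝ F'] [ContMDiffVectorBundle ∞ F V IB]
    [ContMDiffVectorBundle ∞ F' W IB']
    (hΦ : ContMDiff (IB.prod 𝓘(ℝ, F)) (IB'.prod 𝓘(ℝ, F')) ∞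
      fun x : TotalSpace F V => (⟨f x.proj, Φ x.proj x.snd⟩ : TotalSpace F' W))
    {U₀ : Set N} (hU₀ : IsOpen U₀) (hz : ContMDiffOn IN IB ∞ z U₀) {n₀ : N} (hn₀ : n₀ ∈ U₀)
    (hsurj : Function.Surjective (Φ (z n₀))) (hV : z n₀ ∈ eV.baseSet)
    (hW : f (z n₀) ∈ eW.baseSet) :
    ∃ σ : LocalSplitting IN Φ z eV eW (Module.finrank ℝ F - Module.finrank ℝ F'),
      n₀ ∈ σ.source ∧ σ.source ⊆ U₀ := by
  let U₁ := U₀ ∩ z ⁻¹' (eV.baseSet ∩ f ⁻¹' eW.baseSet)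
  have hU₁ : IsOpen U₁ := hz.continuousOn.isOpen_inter_preimage hU₀
    (eV.open_baseSet.inter (eW.open_baseSet.preimage (continuous_base_of_bundleMap hΦ)))
  have hP := contMDiffOn_localRepr (eV := eV) (eW := eW) hΦ hU₁ (hz.mono Set.inter_subset_left)
    (fun n hn => hn.2.1) (fun n hn => hn.2.2)
  obtain ⟨q, hq⟩ := exists_isInvertible_prod_of_surjective _ (localRepr_surjective hV hW hsurj)
  let T : N → F →L[ℝ] (F' × (Fin (Module.finrank ℝ F - Module.finrank ℝ F') → ℝ)) :=
    fun n => (localRepr Φ eV eW (z n)).prod q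
  have hT : ContMDiffOn IN 𝓘(ℝ, _) ∞ T U₁ := contMDiffOn_clm_of_apply fun v =>
    (hP.clm_apply contMDiffOn_const).prodMk_space contMDiffOn_const
  let U := U₁ ∩ T ⁻¹' {A | A.IsInvertible}
  have hU : IsOpen U := hT.continuousOn.isOpen_inter_preimage hU₁ ContinuousLinearEquiv.isOpen
  refine ⟨⟨U, hU, fun n hn => hn.1.2.1, fun n hn => hn.1.2.2, q, fun n hn => hn.2,
    fun n hn => ?_⟩, ⟨⟨hn₀, hV, hW⟩, hq⟩, fun n hn => hn.1.1⟩
  have hn' : (T n).IsInvertible := hn.2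
  exact hn'.contDiffAt_map_inverse.contMDiffAt.comp_contMDiffWithinAt n
    ((hT n hn.1).mono Set.inter_subset_left)

namespace LocalSplitting

variable (σ : LocalSplitting IN Φ z eV eW k)

/-- The isomorphism `W ⊕ ℝᵏ ≅ V` at `z n`, with `W` read in the trivialization `eW`. -/
noncomputable def split (n : N) : (F' × (Fin k → ℝ)) →ₗ[ℝ] V (z n) :=
  eV.symmₗ ℝ (z n) ∘ₗ ((localRepr Φ eV eW (z n)).prod σ.q).inverse.toLinearMap

/-- The right inverse of `Φ` defined by the splitting. -/
noncomputable def lift (n : N) : W (f (z n)) →ₗ[ℝ] V (z n) :=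
  σ.split n ∘ₗ LinearMap.inl ℝ _ _ ∘ₗ eW.linearMapAt ℝ (f (z n))

/-- The frame of the kernel of `Φ` defined by the splitting. -/
noncomputable def kerFrame (n : N) : (Fin k → ℝ) →ₗ[ℝ] V (z n) :=
  σ.split n ∘ₗ LinearMap.inr ℝ _ _

/-- The coordinates with respect to `kerFrame`, extended to all of `V`. -/
noncomputable def kerCoord (b : B) : V b →ₗ[ℝ] (Fin k → ℝ) :=
  σ.q.toLinearMap ∘ₗ eV.linearMapAt ℝ b

variable {σ} {n : N}

theorem map_split (hn : n ∈ σ.source) (x : F' × (Fin k → ℝ)) :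
    eW.linearMapAt ℝ (f (z n)) (Φ (z n) (σ.split n x)) = x.1 ∧
      σ.kerCoord (z n) (σ.split n x) = x.2 := by
  have hx := (σ.isInvertible n hn).self_apply_inverse x
  refine ⟨congrArg Prod.fst hx, ?_⟩
  change σ.q (eV.linearMapAt ℝ (z n) (eV.symmₗ ℝ (z n) _)) = x.2
  rw [eV.linearMapAt_symmₗ (σ.mem_baseSet n hn)]
  exact congrArg Prod.snd hx

theorem split_map (hn : n ∈ σ.source) (v : V (z n)) :
    σ.split n (eW.linearMapAt ℝ (f (z n)) (Φ (z n) v), σ.kerCoord (z n) v) = v := by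
  have hV := σ.mem_baseSet n hn
  have hv := (σ.isInvertible n hn).inverse_apply_self (eV.linearMapAt ℝ (z n) v)
  rw [ContinuousLinearMap.prod_apply, localRepr_linearMapAt hV] at hv
  calc _ = eV.symmₗ ℝ (z n) (eV.linearMapAt ℝ (z n) v) := congrArg (eV.symmₗ ℝ (z n)) hv
    _ = v := eV.symmₗ_linearMapAt hV v

theorem map_lift (hn : n ∈ σ.source) (w : W (f (z n))) : Φ (z n) (σ.lift n w) = w :=
  linearMapAt_injective eW (σ.map_mem_baseSet n hn) (map_split hn _).1

theorem map_kerFrame (hn : n ∈ σ.source) (c : Fin k → ℝ) : Φ (z n) (σ.kerFrame n c) = 0 :=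
  linearMapAt_injective eW (σ.map_mem_baseSet n hn) ((map_split hn _).1.trans (map_zero _).symm)

theorem kerCoord_kerFrame (hn : n ∈ σ.source) (c : Fin k → ℝ) :
    σ.kerCoord (z n) (σ.kerFrame n c) = c := (map_split hn _).2

theorem kerFrame_kerCoord (hn : n ∈ σ.source) {v : V (z n)} (hv : Φ (z n) v = 0) :
    σ.kerFrame n (σ.kerCoord (z n) v) = v := by
  have h := split_map hn v
  rwa [hv, map_zero] at h

section Smooth

variable [ContMDiffVectorBundle ∞ F V IB]
  {EQ : Type*} [NormedAddCommGroup EQ] [NormedSpace ℝ EQ]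
  {HQ : Type*} [TopologicalSpace HQ] {IQ : ModelWithCorners ℝ EQ HQ}
  {Q : Type*} [TopologicalSpace Q] [ChartedSpace HQ Q] {g : Q → N} {q₀ : Q}

theorem contMDiffAt_kerCoord {b : B} (hb : b ∈ eV.baseSet) (v : V b) :
    ContMDiffAt (IB.prod 𝓘(ℝ, F)) 𝓘(ℝ, Fin k → ℝ) ∞
      (fun x : TotalSpace F V => σ.kerCoord x.proj x.snd) ⟨b, v⟩ :=
  σ.q.contMDiff.contMDiffAt.comp _ (contMDiffAt_linearMapAt eV hb contMDiffAt_id)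

theorem contMDiffAt_split (hg : ContMDiffAt IQ IN ∞ g q₀) (hq₀ : g q₀ ∈ σ.source)
    (hz : ContMDiffAt IQ IB ∞ (fun q => z (g q)) q₀) {x : Q → F' × (Fin k → ℝ)}
    (hx : ContMDiffAt IQ 𝓘(ℝ, F' × (Fin k → ℝ)) ∞ x q₀) :
    ContMDiffAt IQ (IB.prod 𝓘(ℝ, F)) ∞
      (fun q => (⟨z (g q), σ.split (g q) (x q)⟩ : TotalSpace F V)) q₀ :=
  contMDiffAt_symmₗ (g := fun q => z (g q)) eV (σ.mem_baseSet _ hq₀) hz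
    (((σ.contMDiffOn_inverse.contMDiffAt (σ.isOpen_source.mem_nhds hq₀)).comp q₀ hg).clm_apply hx)

theorem contMDiffAt_lift [ContMDiffVectorBundle ∞ F' W IB'] (hg : ContMDiffAt IQ IN ∞ g q₀)
    (hq₀ : g q₀ ∈ σ.source) (hz : ContMDiffAt IQ IB ∞ (fun q => z (g q)) q₀)
    {w : (q : Q) → W (f (z (g q)))} (hw : ContMDiffAt IQ (IB'.prod 𝓘(ℝ, F')) ∞
      (fun q => (⟨f (z (g q)), w q⟩ : TotalSpace F' W)) q₀) :
    ContMDiffAt IQ (IB.prod 𝓘(ℝ, F)) ∞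
      (fun q => (⟨z (g q), σ.lift (g q) (w q)⟩ : TotalSpace F V)) q₀ :=
  contMDiffAt_split hg hq₀ hz ((contMDiffAt_linearMapAt eW (σ.map_mem_baseSet _ hq₀)
    hw).prodMk_space contMDiffAt_const)

theorem contMDiffAt_kerFrame (hg : ContMDiffAt IQ IN ∞ g q₀) (hq₀ : g q₀ ∈ σ.source)
    (hz : ContMDiffAt IQ IB ∞ (fun q => z (g q)) q₀) {c : Q → Fin k → ℝ}
    (hc : ContMDiffAt IQ 𝓘(ℝ, Fin k → ℝ) ∞ c q₀) :
    ContMDiffAt IQ (IB.prod 𝓘(ℝ, F)) ∞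
      (fun q => (⟨z (g q), σ.kerFrame (g q) (c q)⟩ : TotalSpace F V)) q₀ :=
  contMDiffAt_split hg hq₀ hz (contMDiffAt_const.prodMk_space hc)

open Classical in
/-- The chart of the kernel of `Φ` defined by the splitting. -/
noncomputable def kernelChart (hz : ContMDiffOn IN IB ∞ z σ.source) :
    SubbundleChart IB F V IN z (fun n => LinearMap.ker (Φ (z n))) k where
  source := σ.source
  isOpen_source := σ.isOpen_source
  coord := σ.kerCoord
  frame n := if hn : n ∈ σ.source then (σ.kerFrame n).codRestrict _ (map_kerFrame hn) else 0
  coord_frame n hn c := by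
    rw [dif_pos hn]
    exact kerCoord_kerFrame hn c
  frame_coord n hn v := by
    rw [dif_pos hn]
    exact Subtype.ext (kerFrame_kerCoord hn v.2)
  contMDiffAt_coord n hn v := contMDiffAt_kerCoord (σ.mem_baseSet n hn) v
  contMDiffOn_frame := by
    have hframe : ContMDiffOn (IN.prod 𝓘(ℝ, Fin k → ℝ)) (IB.prod 𝓘(ℝ, F)) ∞
        (fun x : N × (Fin k → ℝ) => (⟨z x.1, σ.kerFrame x.1 x.2⟩ : TotalSpace F V))
        (σ.source ×ˢ Set.univ) := fun x hx =>
      (contMDiffAt_kerFrame contMDiffAt_fst hx.1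
        ((hz.contMDiffAt (σ.isOpen_source.mem_nhds hx.1)).comp x contMDiffAt_fst)
        contMDiffAt_snd).contMDiffWithinAt
    refine hframe.congr fun x hx => ?_
    rw [dif_pos hx.1]
    rfl

end Smooth

end LocalSplitting

section Kernel

variable [FiniteDimensional ℝ F'] [ContMDiffVectorBundle ∞ F V IB]
  [ContMDiffVectorBundle ∞ F' W IB']
  (hΦ : ContMDiff (IB.prod 𝓘(ℝ, F)) (IB'.prod 𝓘(ℝ, F')) ∞
    fun x : TotalSpace F V => (⟨f x.proj, Φ x.proj x.snd⟩ : TotalSpace F' W))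
include hΦ

theorem exists_subbundleChart_ker (hz : ContMDiff IN IB ∞ z)
    (hsurj : ∀ n, Function.Surjective (Φ (z n))) (n₀ : N) :
    ∃ φ : SubbundleChart IB F V IN z (fun n => LinearMap.ker (Φ (z n)))
      (Module.finrank ℝ F - Module.finrank ℝ F'), n₀ ∈ φ.source := by
  obtain ⟨σ, hσ, -⟩ := exists_localSplitting hΦ isOpen_univ hz.contMDiffOn (Set.mem_univ n₀)
    (hsurj n₀) (FiberBundle.mem_baseSet_trivializationAt F V (z n₀))
    (FiberBundle.mem_baseSet_trivializationAt F' W (f (z n₀)))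
  exact ⟨σ.kernelChart hz.contMDiffOn, hσ⟩

theorem isSmoothSubbundle_ker (hsurj : ∀ b, Function.Surjective (Φ b)) :
    IsSmoothSubbundle IB F fun b => LinearMap.ker (Φ b) :=
  isSmoothSubbundle_of_subbundleChart (exists_subbundleChart_ker hΦ contMDiff_id hsurj)

end Kernel

end LocalSplitting

/-! ### Lie algebroid brackets and morphisms -/

section LieAlgebroidBracket

variable {EB : Type*} [NormedAddCommGroup EB] [NormedSpace ℝ EB]
  {HB : Type*} [TopologicalSpace HB] {IB : ModelWithCorners ℝ EB HB}
  {B : Type*} [TopologicalSpace B] [ChartedSpace HB B]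
  {F : Type*} [NormedAddCommGroup F] [NormedSpace ℝ F]
  {V : B → Type*} [TopologicalSpace (TotalSpace F V)]
  [∀ b, AddCommGroup (V b)] [∀ b, Module ℝ (V b)] [∀ b, TopologicalSpace (V b)]
  [FiberBundle F V] [VectorBundle ℝ F V]

/-- The product of a smooth function and a smooth section. -/
noncomputable def smulSection (f : C^∞⟮IB, B; ℝ⟯) (X : Cₛ^∞⟮IB; F, V⟯) : Cₛ^∞⟮IB; F, V⟯ :=
  ⟨fun b => f b • X b, f.contMDiff.smul_section X.contMDiff⟩

theorem smulSection_apply (f : C^∞⟮IB, B; ℝ⟯) (X : Cₛ^∞⟮IB; F, V⟯) (b : B) :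
    smulSection f X b = f b • X b := rfl

theorem contMDiffSection_sum_apply {ι : Type*} (s : Finset ι) (X : ι → Cₛ^∞⟮IB; F, V⟯) (b : B) :
    (∑ i ∈ s, X i) b = ∑ i ∈ s, X i b := by
  rw [← Finset.sum_apply]
  exact congrFun (map_sum (ContMDiffSection.coeAddHom IB F ∞ V) X s) b

section Kernel

variable {W : B → Type*} [∀ b, AddCommGroup (W b)] [∀ b, Module ℝ (W b)]
  {φ : (b : B) → V b →ₗ[ℝ] W b} {ι : Type*} [Fintype ι]

theorem exists_eq_sum_smulSection_add_ker {X : Cₛ^∞⟮IB; F, V⟯} {u : ι → C^∞⟮IB, B; ℝ⟯}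
    {Z : ι → Cₛ^∞⟮IB; F, V⟯} (hX : ∀ b, φ b (X b) = ∑ i, u i b • φ b (Z i b)) :
    ∃ X' : Cₛ^∞⟮IB; F, V⟯, (∀ b, φ b (X' b) = 0) ∧ X = ∑ i, smulSection (u i) (Z i) + X' := by
  refine ⟨X - ∑ i, smulSection (u i) (Z i), fun b => ?_, (add_sub_cancel _ _).symm⟩
  rw [ContMDiffSection.coe_sub, Pi.sub_apply, contMDiffSection_sum_apply, map_sub, hX, map_sum,
    sub_eq_zero]
  simp only [smulSection_apply, map_smul]

end Kernel

namespace LieAlgebroid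

variable [IsManifold IB ∞ B] (L : LieAlgebroid IB F V)

theorem bracket_swap (X Y : Cₛ^∞⟮IB; F, V⟯) : L.bracket X Y = -L.bracket Y X := by
  have h := L.bracket_self (X + Y)
  rw [L.bracket.map_add, LinearMap.add_apply, map_add, map_add, L.bracket_self, L.bracket_self,
    zero_add, add_zero] at h
  exact eq_neg_of_add_eq_zero_left h

/-- The derivative of `u` along the anchor, as a linear form on the fibre at `b`. -/
noncomputable def anchorDeriv (u : C^∞⟮IB, B; ℝ⟯) (b : B) : V b →ₗ[ℝ] ℝ :=
  (mfderiv IB 𝓘(ℝ, ℝ) u b : TangentSpace IB b →L[ℝ] ℝ).toLinearMap ∘ₗ L.anchor b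

theorem bracket_smulSection (X Y : Cₛ^∞⟮IB; F, V⟯) (f : C^∞⟮IB, B; ℝ⟯) (b : B) :
    L.bracket X (smulSection f Y) b = f b • L.bracket X Y b + L.anchorDeriv f b (X b) • Y b :=
  L.leibniz X Y _ f (smulSection_apply f Y) b

theorem smulSection_bracket (X Y : Cₛ^∞⟮IB; F, V⟯) (f : C^∞⟮IB, B; ℝ⟯) (b : B) :
    L.bracket (smulSection f X) Y b = f b • L.bracket X Y b - L.anchorDeriv f b (Y b) • X b := by
  rw [L.bracket_swap _ Y, L.bracket_swap X Y, ContMDiffSection.coe_neg, Pi.neg_apply,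
    L.bracket_smulSection, ContMDiffSection.coe_neg, Pi.neg_apply, smul_neg]
  abel

theorem bracket_sum {ι : Type*} (s : Finset ι) (X : Cₛ^∞⟮IB; F, V⟯) (Y : ι → Cₛ^∞⟮IB; F, V⟯)
    (b : B) : L.bracket X (∑ i ∈ s, Y i) b = ∑ i ∈ s, L.bracket X (Y i) b := by
  rw [map_sum, contMDiffSection_sum_apply]

theorem sum_bracket {ι : Type*} (s : Finset ι) (X : ι → Cₛ^∞⟮IB; F, V⟯) (Y : Cₛ^∞⟮IB; F, V⟯)
    (b : B) : L.bracket (∑ i ∈ s, X i) Y b = ∑ i ∈ s, L.bracket (X i) Y b := by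
  rw [map_sum, LinearMap.sum_apply, contMDiffSection_sum_apply]

theorem add_bracket_apply (X X' Y : Cₛ^∞⟮IB; F, V⟯) (b : B) :
    L.bracket (X + X') Y b = L.bracket X Y b + L.bracket X' Y b := by
  rw [map_add, LinearMap.add_apply, ContMDiffSection.coe_add, Pi.add_apply]

theorem bracket_add_apply (X Y Y' : Cₛ^∞⟮IB; F, V⟯) (b : B) :
    L.bracket X (Y + Y') b = L.bracket X Y b + L.bracket X Y' b := by
  rw [map_add, ContMDiffSection.coe_add, Pi.add_apply]

section Kernel

variable {W : B → Type*} [∀ b, AddCommGroup (W b)] [∀ b, Module ℝ (W b)]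
  {φ : (b : B) → V b →ₗ[ℝ] W b} {ι : Type*} [Fintype ι]

theorem map_bracket_eq_zero_of_sum {S Y : Cₛ^∞⟮IB; F, V⟯} {b : B} {u : C^∞⟮IB, B; ℝ⟯}
    (hu : u b = 1) {g : ι → C^∞⟮IB, B; ℝ⟯} {K : ι → Cₛ^∞⟮IB; F, V⟯}
    (hY : ∀ b, u b • Y b = ∑ i, g i b • K i b) (hφY : φ b (Y b) = 0) (hφK : ∀ i, φ b (K i b) = 0)
    (hSK : ∀ i, φ b (L.bracket S (K i) b) = 0) : φ b (L.bracket S Y b) = 0 := by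
  have hsum : smulSection u Y = ∑ i, smulSection (g i) (K i) := by
    ext b
    rw [contMDiffSection_sum_apply]
    exact hY b
  calc φ b (L.bracket S Y b) = φ b (L.bracket S (smulSection u Y) b) := by
        rw [L.bracket_smulSection, map_add, map_smul, map_smul, hφY, hu, one_smul, smul_zero,
          add_zero]
    _ = ∑ i, φ b (L.bracket S (smulSection (g i) (K i)) b) := by
        rw [hsum, L.bracket_sum, map_sum]
    _ = 0 := Finset.sum_eq_zero fun i _ => by
        rw [L.bracket_smulSection, map_add, map_smul, map_smul, hSK, hφK, smul_zero, smul_zero,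
          add_zero]

end Kernel

variable {EB' : Type*} [NormedAddCommGroup EB'] [NormedSpace ℝ EB']
  {HB' : Type*} [TopologicalSpace HB'] {IB' : ModelWithCorners ℝ EB' HB'}
  {B' : Type*} [TopologicalSpace B'] [ChartedSpace HB' B']
  {F' : Type*} [NormedAddCommGroup F'] [NormedSpace ℝ F']
  {W : B' → Type*} [TopologicalSpace (TotalSpace F' W)]
  [∀ b, AddCommGroup (W b)] [∀ b, Module ℝ (W b)] [∀ b, TopologicalSpace (W b)]
  [FiberBundle F' W] [VectorBundle ℝ F' W] [IsManifold IB' ∞ B']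
  {f : B → B'} {φ : (b : B) → V b →ₗ[ℝ] W (f b)} (LW : LieAlgebroid IB' F' W)

variable (φ) in
/-- `hor` lifts sections of `W` through the bundle map `φ : V → W` so that the bracket of `V` is
compatible with that of `W` on lifted sections and on sections of the kernel. -/
structure IsBracketLift (hor : Cₛ^∞⟮IB'; F', W⟯ → Cₛ^∞⟮IB; F, V⟯) : Prop where
  map_hor : ∀ a b, φ b (hor a b) = a (f b)
  map_bracket_hor : ∀ a c b, φ b (L.bracket (hor a) (hor c) b) = LW.bracket a c (f b)
  map_bracket_hor_ker : ∀ (a : Cₛ^∞⟮IB'; F', W⟯) (Y : Cₛ^∞⟮IB; F, V⟯), (∀ b, φ b (Y b) = 0) →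
    ∀ b, φ b (L.bracket (hor a) Y b) = 0
  map_bracket_ker_ker : ∀ X Y : Cₛ^∞⟮IB; F, V⟯, (∀ b, φ b (X b) = 0) → (∀ b, φ b (Y b) = 0) →
    ∀ b, φ b (L.bracket X Y b) = 0

namespace IsBracketLift

variable {L LW} {hor : Cₛ^∞⟮IB'; F', W⟯ → Cₛ^∞⟮IB; F, V⟯} (h : L.IsBracketLift φ LW hor)
  {X Y : Cₛ^∞⟮IB; F, V⟯} {ι : Type*} [Fintype ι] {u : ι → C^∞⟮IB, B; ℝ⟯}
  {a : ι → Cₛ^∞⟮IB'; F', W⟯}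

include h

theorem exists_eq_sum_hor_add_ker (hX : ∀ b, φ b (X b) = ∑ i, u i b • a i (f b)) :
    ∃ X' : Cₛ^∞⟮IB; F, V⟯, (∀ b, φ b (X' b) = 0) ∧
      X = ∑ i, smulSection (u i) (hor (a i)) + X' :=
  exists_eq_sum_smulSection_add_ker fun b => by simp only [hX, h.map_hor]

theorem map_bracket_ker_hor (c : Cₛ^∞⟮IB'; F', W⟯) (hX : ∀ b, φ b (X b) = 0) (b : B) :
    φ b (L.bracket X (hor c) b) = 0 := by
  rw [L.bracket_swap, ContMDiffSection.coe_neg, Pi.neg_apply, map_neg,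
    h.map_bracket_hor_ker c X hX, neg_zero]

theorem map_bracket_hor_right (hX : ∀ b, φ b (X b) = ∑ i, u i b • a i (f b))
    (c : Cₛ^∞⟮IB'; F', W⟯) (b : B) :
    φ b (L.bracket X (hor c) b) = ∑ i, u i b • LW.bracket (a i) c (f b)
      - ∑ i, L.anchorDeriv (u i) b (hor c b) • a i (f b) := by
  obtain ⟨X', hX', rfl⟩ := h.exists_eq_sum_hor_add_ker hX
  rw [add_bracket_apply, map_add, h.map_bracket_ker_hor c hX', add_zero, L.sum_bracket, map_sum,
    ← Finset.sum_sub_distrib]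
  simp only [L.smulSection_bracket, map_sub, map_smul, h.map_hor, h.map_bracket_hor]

theorem map_bracket_ker_right (hX : ∀ b, φ b (X b) = ∑ i, u i b • a i (f b))
    (hY : ∀ b, φ b (Y b) = 0) (b : B) :
    φ b (L.bracket X Y b) = -∑ i, L.anchorDeriv (u i) b (Y b) • a i (f b) := by
  obtain ⟨X', hX', rfl⟩ := h.exists_eq_sum_hor_add_ker hX
  rw [add_bracket_apply, map_add, h.map_bracket_ker_ker _ _ hX' hY, add_zero, L.sum_bracket,
    map_sum, ← Finset.sum_neg_distrib]
  simp only [L.smulSection_bracket, map_sub, map_smul, h.map_hor, h.map_bracket_hor_ker _ _ hY,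
    smul_zero, zero_sub]

theorem map_bracket {κ : Type*} [Fintype κ] {v : κ → C^∞⟮IB, B; ℝ⟯}
    {c : κ → Cₛ^∞⟮IB'; F', W⟯} (hX : ∀ b, φ b (X b) = ∑ i, u i b • a i (f b))
    (hY : ∀ b, φ b (Y b) = ∑ j, v j b • c j (f b)) (b : B) :
    φ b (L.bracket X Y b) =
      ∑ i, ∑ j, (u i b * v j b) • LW.bracket (a i) (c j) (f b)
      + ∑ j, L.anchorDeriv (v j) b (X b) • c j (f b)
      - ∑ i, L.anchorDeriv (u i) b (Y b) • a i (f b) := by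
  obtain ⟨Y', hY', rfl⟩ := h.exists_eq_sum_hor_add_ker hY
  have hderiv (i : ι) : L.anchorDeriv (u i) b ((∑ j, smulSection (v j) (hor (c j)) + Y') b) =
      ∑ j, v j b * L.anchorDeriv (u i) b (hor (c j) b) + L.anchorDeriv (u i) b (Y' b) := by
    rw [ContMDiffSection.coe_add, Pi.add_apply, contMDiffSection_sum_apply, map_add, map_sum]
    simp only [smulSection_apply, map_smul, smul_eq_mul]
  have hhor (j : κ) : φ b (L.bracket X (smulSection (v j) (hor (c j))) b) =
      ∑ i, (u i b * v j b) • LW.bracket (a i) (c j) (f b)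
      - ∑ i, (v j b * L.anchorDeriv (u i) b (hor (c j) b)) • a i (f b)
      + L.anchorDeriv (v j) b (X b) • c j (f b) := by
    rw [L.bracket_smulSection, map_add, map_smul, map_smul, h.map_hor,
      h.map_bracket_hor_right hX, smul_sub, Finset.smul_sum, Finset.smul_sum]
    simp only [smul_smul, mul_comm (v j b) (u _ b)]
  rw [bracket_add_apply, map_add, h.map_bracket_ker_right hX hY', L.bracket_sum, map_sum]
  simp only [hhor, hderiv, add_smul, Finset.sum_smul, Finset.sum_add_distrib,
    Finset.sum_sub_distrib]
  rw [Finset.sum_comm (f := fun j i => (u i b * v j b) • LW.bracket (a i) (c j) (f b)),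
    Finset.sum_comm (f := fun j i => (v j b * L.anchorDeriv (u i) b (hor (c j) b)) • a i (f b))]
  abel

end IsBracketLift

end LieAlgebroid

end LieAlgebroidBracket

/-! ### Integral curves of linear vector fields -/

section RelatedVectorFields

variable {EN : Type*} [NormedAddCommGroup EN] [NormedSpace ℝ EN]
  {HN : Type*} [TopologicalSpace HN] {I : ModelWithCorners ℝ EN HN}
  {N : Type*} [TopologicalSpace N] [ChartedSpace HN N]
  {EN' : Type*} [NormedAddCommGroup EN'] [NormedSpace ℝ EN']
  {HN' : Type*} [TopologicalSpace HN'] {I' : ModelWithCorners ℝ EN' HN'}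
  {N' : Type*} [TopologicalSpace N'] [ChartedSpace HN' N']
  {v : (x : N) → TangentSpace I x} {w : (x : N') → TangentSpace I' x}

theorem isMIntegralCurveOn_comp_of_related {γ : ℝ → N} {s : Set ℝ} {g : N → N'}
    (hγ : IsMIntegralCurveOn γ v s) (hg : ∀ t ∈ s, MDifferentiableAt I I' g (γ t))
    (h : ∀ t ∈ s, mfderiv I I' g (γ t) (v (γ t)) = w (g (γ t))) :
    IsMIntegralCurveOn (g ∘ γ) w s := fun t ht => by
  have hcomp := (hg t ht).hasMFDerivAt.comp_hasMFDerivWithinAt t (hγ t ht)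
  have hderiv : (mfderiv I I' g (γ t)).comp ((1 : ℝ →L[ℝ] ℝ).smulRight (v (γ t))) =
      (1 : ℝ →L[ℝ] ℝ).smulRight (w (g (γ t))) := by
    rw [← h t ht]
    ext
    simp
  exact hderiv ▸ hcomp

end RelatedVectorFields

section LocalExistence

variable {EN : Type*} [NormedAddCommGroup EN] [NormedSpace ℝ EN]
  {HN : Type*} [TopologicalSpace HN] {I : ModelWithCorners ℝ EN HN}
  {N : Type*} [TopologicalSpace N] [ChartedSpace HN N]
  {v : (x : N) → TangentSpace I x} {x x₀ : N} {ε T : ℝ}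

/-- The vector field `v` has an integral curve through `x` on the time interval `(-ε, ε)`; this is
the form in which existence times of integral curves are compared. -/
def HasIntegralCurve (v : (x : N) → TangentSpace I x) (x : N) (ε : ℝ) : Prop :=
  ∃ γ : ℝ → N, γ 0 = x ∧ IsMIntegralCurveOn γ v (Set.Ioo (-ε) ε)

theorem HasIntegralCurve.mono (h : HasIntegralCurve v x ε) (hT : T ≤ ε) :
    HasIntegralCurve v x T := by
  obtain ⟨γ, hγ0, hγ⟩ := h
  exact ⟨γ, hγ0, hγ.mono (Set.Ioo_subset_Ioo (neg_le_neg hT) hT)⟩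

variable [IsManifold I 1 N]

theorem isMIntegralCurveOn_extChartAt_symm_comp {f : ℝ → EN} {s : Set ℝ}
    (hf : ∀ t ∈ s, HasDerivAt f (mfderiv I 𝓘(ℝ, EN) (extChartAt I x₀)
      ((extChartAt I x₀).symm (f t)) (v ((extChartAt I x₀).symm (f t)))) t)
    (hs : ∀ t ∈ s, f t ∈ interior (extChartAt I x₀).target) :
    IsMIntegralCurveOn ((extChartAt I x₀).symm ∘ f) v s := by
  have hrange (t : ℝ) (ht : t ∈ s) : Set.range I ∈ 𝓝 (f t) :=
    Filter.mem_of_superset (isOpen_interior.mem_nhds (hs t ht))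
      (interior_subset.trans (extChartAt_target_subset_range x₀))
  have hint : IsMIntegralCurveOn f (fun y : EN => mfderiv I 𝓘(ℝ, EN) (extChartAt I x₀)
      ((extChartAt I x₀).symm y) (v ((extChartAt I x₀).symm y))) s := fun t ht =>
    (hf t ht).hasFDerivAt.hasMFDerivAt.hasMFDerivWithinAt
  refine isMIntegralCurveOn_comp_of_related hint (fun t ht => ?_) fun t ht => ?_
  · exact (mdifferentiableWithinAt_extChartAt_symm (interior_subset (hs t ht))).mdifferentiableAt
      (hrange t ht)
  · rw [← mfderivWithin_of_mem_nhds (hrange t ht)]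
    exact congrArg (fun L => L (v _))
      (mfderivWithin_extChartAt_symm_comp_mfderiv_extChartAt (interior_subset (hs t ht)))

theorem exists_hasIntegralCurve_nhds [CompleteSpace EN] [BoundarylessManifold I N]
    (hv : ContMDiffAt I I.tangent 1 (fun x => (⟨x, v x⟩ : TangentBundle I N)) x₀) :
    ∃ U ∈ 𝓝 x₀, ∃ ε > 0, ∀ x ∈ U, HasIntegralCurve v x ε := by
  have hx₀ : I.IsInteriorPoint x₀ := BoundarylessManifold.isInteriorPoint
  obtain ⟨ε, hε, a, r, _, _, hr, hpl⟩ := IsPicardLindelof.of_contDiffAt_one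
    ((contMDiffAt_iff.1 hv).2.contDiffAt (range_mem_nhds_isInteriorPoint hx₀)).snd
  obtain ⟨α, hα, hαc⟩ := (hpl 0).exists_forall_mem_closedBall_eq_hasDerivWithinAt_continuousOn
  simp only [zero_sub, zero_add] at hα hαc
  set φ := extChartAt I x₀
  have hball : Metric.closedBall (φ x₀) r ∈ 𝓝 (φ x₀) := Metric.closedBall_mem_nhds _ hr
  have hα0 : α (φ x₀, 0) = φ x₀ := (hα _ (mem_of_mem_nhds hball)).1
  have htarget : α ⁻¹' interior φ.target ∈ 𝓝 (φ x₀, (0 : ℝ)) := by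
    refine (hαc.continuousAt (prod_mem_nhds hball (Icc_mem_nhds (neg_lt_zero.2 hε) hε)))
      (isOpen_interior.mem_nhds ?_)
    rw [hα0]
    exact I.isInteriorPoint_iff.1 hx₀
  obtain ⟨W, hW, J, hJ, hWJ⟩ := mem_nhds_prod_iff.1 htarget
  obtain ⟨δ, hδ, hδJ⟩ := Metric.mem_nhds_iff.1 hJ
  refine ⟨φ ⁻¹' (W ∩ Metric.closedBall (φ x₀) r) ∩ φ.source,
    Filter.inter_mem (continuousAt_extChartAt x₀ (Filter.inter_mem hW hball))
      (extChartAt_source_mem_nhds x₀), min δ ε, lt_min hδ hε, fun x hx => ?_⟩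
  refine ⟨φ.symm ∘ fun t => α (φ x, t), ?_, ?_⟩
  · rw [Function.comp_apply, (hα _ hx.1.2).1, φ.left_inv hx.2]
  have hint (t : ℝ) (ht : t ∈ Set.Ioo (-min δ ε) (min δ ε)) :
      α (φ x, t) ∈ interior φ.target := by
    refine hWJ ⟨hx.1.1, hδJ ?_⟩
    rw [Real.ball_eq_Ioo, zero_sub, zero_add]
    exact Set.Ioo_subset_Ioo (neg_le_neg (min_le_left _ _)) (min_le_left _ _) ht
  refine isMIntegralCurveOn_extChartAt_symm_comp (fun t ht => ?_) hint
  have htε : t ∈ Set.Ioo (-ε) ε :=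
    Set.Ioo_subset_Ioo (neg_le_neg (min_le_right _ _)) (min_le_right _ _) ht
  rw [(mdifferentiableAt_extChartAt ((extChartAt_source I x₀).subset
    (φ.map_target (interior_subset (hint t ht))))).mfderiv]
  exact ((hα _ hx.1.2).2 t (Set.Ioo_subset_Icc_self htε)).hasDerivAt
    (Icc_mem_nhds htε.1 htε.2)

end LocalExistence

section Extension

variable {EN : Type*} [NormedAddCommGroup EN] [NormedSpace ℝ EN]
  {HN : Type*} [TopologicalSpace HN] {I : ModelWithCorners ℝ EN HN}
  {N : Type*} [TopologicalSpace N] [ChartedSpace HN N] [IsManifold I 1 N]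
  [T2Space N] [BoundarylessManifold I N] {v : (x : N) → TangentSpace I x} {x : N} {ε s T : ℝ}
  (hv : ContMDiff I I.tangent 1 (fun x => (⟨x, v x⟩ : TangentBundle I N)))

include hv

theorem exists_isMIntegralCurveOn_Ioo_union {γ : ℝ → N} {a b t₀ : ℝ}
    (hγ : IsMIntegralCurveOn γ v (Set.Ioo a b)) (ht₀ : t₀ ∈ Set.Ioo a b) (hε : 0 < ε)
    (h : HasIntegralCurve v (γ t₀) ε) :
    ∃ γ', Set.EqOn γ' γ (Set.Ioo a b) ∧
      IsMIntegralCurveOn γ' v (Set.Ioo a b ∪ Set.Ioo (t₀ - ε) (t₀ + ε)) := by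
  obtain ⟨β, hβ0, hβ⟩ := h
  have hβ' : IsMIntegralCurveOn (β ∘ (· - t₀)) v (Set.Ioo (t₀ - ε) (t₀ + ε)) := by
    refine (isMIntegralCurveOn_comp_sub.2 hβ).mono fun t ht => ?_
    constructor <;> linarith [ht.1, ht.2]
  exact ⟨_, Set.piecewise_eqOn _ _ _, isMIntegralCurveOn_piecewise hv hγ hβ'
    ⟨ht₀, by linarith, by linarith⟩ (by rw [Function.comp_apply, sub_self, hβ0])⟩

theorem exists_isMIntegralCurveOn_Ioo_add {γ : ℝ → N}
    (hγ : IsMIntegralCurveOn γ v (Set.Ioo (-s) s)) (hε : 0 < ε) (hεs : ε ≤ s)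
    (hr : HasIntegralCurve v (γ (s - ε / 2)) ε) (hl : HasIntegralCurve v (γ (-(s - ε / 2))) ε) :
    HasIntegralCurve v (γ 0) (s + ε / 2) := by
  obtain ⟨γ₁, heq₁, hγ₁⟩ := exists_isMIntegralCurveOn_Ioo_union hv hγ
    (t₀ := s - ε / 2) ⟨by linarith, by linarith⟩ hε hr
  have hγ₁' : IsMIntegralCurveOn γ₁ v (Set.Ioo (-s) (s + ε / 2)) :=
    hγ₁.mono ((Set.Ioo_subset_Ioo_union_Ioo le_rfl (by linarith) (by linarith)))
  have heql : γ₁ (-(s - ε / 2)) = γ (-(s - ε / 2)) := heq₁ ⟨by linarith, by linarith⟩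
  obtain ⟨γ₂, heq₂, hγ₂⟩ := exists_isMIntegralCurveOn_Ioo_union hv hγ₁'
    (t₀ := -(s - ε / 2)) ⟨by linarith, by linarith⟩ hε (heql ▸ hl)
  refine ⟨γ₂, (heq₂ ⟨by linarith, by linarith⟩).trans (heq₁ ⟨by linarith, by linarith⟩), ?_⟩
  rw [Set.union_comm] at hγ₂
  exact hγ₂.mono (Set.Ioo_subset_Ioo_union_Ioo (by linarith) (by linarith) le_rfl)

theorem hasIntegralCurve_of_uniform (hε : 0 < ε) (hx : HasIntegralCurve v x ε)
    (h : ∀ (γ : ℝ → N) (s : ℝ), γ 0 = x → IsMIntegralCurveOn γ v (Set.Ioo (-s) s) →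
      ∀ t ∈ Set.Ioo (-s) s, |t| ≤ T → HasIntegralCurve v (γ t) ε) :
    HasIntegralCurve v x T := by
  have key (n : ℕ) : HasIntegralCurve v x (min T (ε + n * (ε / 2))) := by
    induction n with
    | zero => exact hx.mono ((min_le_right _ _).trans (by simp))
    | succ n ih =>
      rcases le_or_gt T (ε + n * (ε / 2)) with hT | hT
      · exact ih.mono (le_min (min_le_left _ _) ((min_le_left _ _).trans hT))
      rw [min_eq_right hT.le] at ih
      set s := ε + n * (ε / 2)
      have hεs : ε ≤ s := le_add_of_nonneg_right (by positivity)
      obtain ⟨γ, rfl, hγ⟩ := ih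
      have habs : |s - ε / 2| ≤ T := abs_le.2 ⟨by linarith, by linarith⟩
      refine (exists_isMIntegralCurveOn_Ioo_add hv hγ hε hεs
        (h γ s rfl hγ _ ⟨by linarith, by linarith⟩ habs)
        (h γ s rfl hγ _ ⟨by linarith, by linarith⟩ (by rwa [abs_neg]))).mono
        ((min_le_right _ _).trans_eq ?_)
      push_cast
      ring
  obtain ⟨n, hn⟩ := exists_nat_ge (T / (ε / 2))
  exact (key n).mono (le_min le_rfl
    (((div_le_iff₀ (half_pos hε)).1 hn).trans (le_add_of_nonneg_left hε.le)))

end Extension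

section ShrinkToZeroSection

variable {B : Type*} [TopologicalSpace B] {F : Type*} [NormedAddCommGroup F] [NormedSpace ℝ F]
  {V : B → Type*} [TopologicalSpace (TotalSpace F V)]
  [∀ b, AddCommGroup (V b)] [∀ b, Module ℝ (V b)] [∀ b, TopologicalSpace (V b)]
  [FiberBundle F V] [VectorBundle ℝ F V]

theorem continuous_fibreSMul_left (x : TotalSpace F V) :
    Continuous fun t : ℝ => fibreSMul t x := by
  have e := (trivializationAt F V x.proj).continuousLinearEquivAt ℝ x.proj
    (FiberBundle.mem_baseSet_trivializationAt F V x.proj)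
  have hline : Continuous fun t : ℝ => t • x.snd := by
    have h : Continuous fun t : ℝ => e.symm (t • e x.snd) := by fun_prop
    simpa only [map_smul, e.symm_apply_apply] using h
  exact (FiberBundle.continuous_totalSpaceMk F V x.proj).comp hline

theorem exists_fibreSMul_mem_nhds {b₀ : B} {W : Set (TotalSpace F V)}
    (hW : W ∈ 𝓝 (⟨b₀, 0⟩ : TotalSpace F V)) :
    ∃ U ∈ 𝓝 b₀, ∀ x : TotalSpace F V, x.proj ∈ U → ∃ t : ℝ, t ≠ 0 ∧ fibreSMul t x ∈ W := by
  have hcont : Continuous (zeroSection F V) := Bundle.Trivialization.continuous_zeroSection ℝ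
  refine ⟨zeroSection F V ⁻¹' interior W,
    hcont.continuousAt.preimage_mem_nhds (interior_mem_nhds.2 hW), fun x hx => ?_⟩
  have h0 : fibreSMul 0 x = zeroSection F V x.proj := congrArg _ (zero_smul ℝ x.snd)
  have hmem : ∀ᶠ t in 𝓝 (0 : ℝ), fibreSMul t x ∈ W :=
    (continuous_fibreSMul_left x).continuousAt (mem_interior_iff_mem_nhds.1 (h0 ▸ hx))
  exact (eventually_mem_nhdsWithin.and (hmem.filter_mono (nhdsWithin_le_nhds (s := {0}ᶜ)))).exists

end ShrinkToZeroSection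

section HomogeneousVectorField

variable {EM : Type*} [NormedAddCommGroup EM] [NormedSpace ℝ EM]
  {M : Type*} [TopologicalSpace M] [ChartedSpace EM M]
  {FE : Type*} [NormedAddCommGroup FE] [NormedSpace ℝ FE]
  {E : M → Type*} [TopologicalSpace (TotalSpace FE E)]
  [∀ m, AddCommGroup (E m)] [∀ m, Module ℝ (E m)] [∀ m, TopologicalSpace (E m)]
  [FiberBundle FE E] [VectorBundle ℝ FE E]

variable {Z : (e : TotalSpace FE E) → TangentSpace (𝓘(ℝ, EM).prod 𝓘(ℝ, FE)) e}
  {Y : (m : M) → TangentSpace 𝓘(ℝ, EM) m} {ε : ℝ}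

/-- The vector field `Z` on the total space of a vector bundle is invariant under the fibrewise
scalar multiplications. -/
def IsHomogeneousVectorField
    (Z : (e : TotalSpace FE E) → TangentSpace (𝓘(ℝ, EM).prod 𝓘(ℝ, FE)) e) : Prop :=
  ∀ (t : ℝ) (e : TotalSpace FE E), mfderiv (𝓘(ℝ, EM).prod 𝓘(ℝ, FE))
    (𝓘(ℝ, EM).prod 𝓘(ℝ, FE)) (fibreSMul t) e (Z e) = Z (fibreSMul t e)

theorem IsHomogeneousVectorField.hasIntegralCurve_of_fibreSMul (hZ : IsHomogeneousVectorField Z)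
    {s : ℝ} (hs : s ≠ 0) {e : TotalSpace FE E} (h : HasIntegralCurve Z (fibreSMul s e) ε) :
    HasIntegralCurve Z e ε := by
  obtain ⟨γ, hγ0, hγ⟩ := h
  refine ⟨fibreSMul s⁻¹ ∘ γ, ?_, isMIntegralCurveOn_comp_of_related hγ
    (fun t _ => (contMDiff_fibreSMul s⁻¹).mdifferentiable (by simp) _) fun t _ => hZ s⁻¹ _⟩
  rw [Function.comp_apply, hγ0]
  exact congrArg (TotalSpace.mk e.proj) (inv_smul_smul₀ hs e.snd)

variable [FiniteDimensional ℝ EM] [IsManifold 𝓘(ℝ, EM) ∞ M] [FiniteDimensional ℝ FE]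
  [ContMDiffVectorBundle ∞ FE E 𝓘(ℝ, EM)]

theorem IsHomogeneousVectorField.exists_hasIntegralCurve_nhds (hZ : IsHomogeneousVectorField Z)
    (hZs : ContMDiff (𝓘(ℝ, EM).prod 𝓘(ℝ, FE)) (𝓘(ℝ, EM).prod 𝓘(ℝ, FE)).tangent 1
      (fun e => (⟨e, Z e⟩ : TangentBundle (𝓘(ℝ, EM).prod 𝓘(ℝ, FE)) (TotalSpace FE E)))) (m₀ : M) :
    ∃ U ∈ 𝓝 m₀, ∃ ε > 0, ∀ e : TotalSpace FE E, e.proj ∈ U → HasIntegralCurve Z e ε := by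
  have : CompleteSpace EM := FiniteDimensional.complete ℝ EM
  have : CompleteSpace FE := FiniteDimensional.complete ℝ FE
  have : IsManifold (𝓘(ℝ, EM).prod 𝓘(ℝ, FE)) 1 (TotalSpace FE E) :=
    IsManifold.of_le (n := ∞) (mod_cast le_top)
  obtain ⟨W, hW, ε, hε, hWε⟩ := _root_.exists_hasIntegralCurve_nhds (hZs ⟨m₀, 0⟩)
  obtain ⟨U, hU, hUW⟩ := exists_fibreSMul_mem_nhds hW
  refine ⟨U, hU, ε, hε, fun e he => ?_⟩
  obtain ⟨s, hs, hse⟩ := hUW e he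
  exact hZ.hasIntegralCurve_of_fibreSMul hs (hWε _ hse)

theorem IsHomogeneousVectorField.exists_hasIntegralCurve_compact
    (hZ : IsHomogeneousVectorField Z)
    (hZs : ContMDiff (𝓘(ℝ, EM).prod 𝓘(ℝ, FE)) (𝓘(ℝ, EM).prod 𝓘(ℝ, FE)).tangent 1
      (fun e => (⟨e, Z e⟩ : TangentBundle (𝓘(ℝ, EM).prod 𝓘(ℝ, FE)) (TotalSpace FE E))))
    {K : Set M} (hK : IsCompact K) :
    ∃ ε > 0, ∀ e : TotalSpace FE E, e.proj ∈ K → HasIntegralCurve Z e ε := by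
  refine hK.induction_on ⟨1, one_pos, fun _ h => h.elim⟩ ?_ ?_ fun m _ => ?_
  · rintro s t hst ⟨ε, hε, h⟩
    exact ⟨ε, hε, fun e he => h e (hst he)⟩
  · rintro s t ⟨ε, hε, h⟩ ⟨ε', hε', h'⟩
    exact ⟨min ε ε', lt_min hε hε', fun e he => he.elim
      (fun he => (h e he).mono (min_le_left _ _)) fun he => (h' e he).mono (min_le_right _ _)⟩
  · obtain ⟨U, hU, h⟩ := hZ.exists_hasIntegralCurve_nhds hZs m
    exact ⟨U, mem_nhdsWithin_of_mem_nhds hU, h⟩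

theorem IsHomogeneousVectorField.isCompleteVectorField [T2Space M]
    (hZ : IsHomogeneousVectorField Z)
    (hZs : ContMDiff (𝓘(ℝ, EM).prod 𝓘(ℝ, FE)) (𝓘(ℝ, EM).prod 𝓘(ℝ, FE)).tangent 1
      (fun e => (⟨e, Z e⟩ : TangentBundle (𝓘(ℝ, EM).prod 𝓘(ℝ, FE)) (TotalSpace FE E))))
    (hYs : ContMDiff 𝓘(ℝ, EM) 𝓘(ℝ, EM).tangent 1
      (fun m => (⟨m, Y m⟩ : TangentBundle 𝓘(ℝ, EM) M)))
    (hZY : ∀ e : TotalSpace FE E, mfderiv (𝓘(ℝ, EM).prod 𝓘(ℝ, FE)) 𝓘(ℝ, EM)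
      (TotalSpace.proj : TotalSpace FE E → M) e (Z e) = Y e.proj)
    (hY : IsCompleteVectorField 𝓘(ℝ, EM) Y) :
    IsCompleteVectorField (𝓘(ℝ, EM).prod 𝓘(ℝ, FE)) Z := by
  have : CompleteSpace EM := FiniteDimensional.complete ℝ EM
  have : CompleteSpace FE := FiniteDimensional.complete ℝ FE
  have : IsManifold (𝓘(ℝ, EM).prod 𝓘(ℝ, FE)) 1 (TotalSpace FE E) :=
    IsManifold.of_le (n := ∞) (mod_cast le_top)
  have : IsManifold 𝓘(ℝ, EM) 1 M := IsManifold.of_le (n := ∞) (mod_cast le_top)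
  have : T2Space (TotalSpace FE E) := t2Space_totalSpace
  intro e
  obtain ⟨c, hc0, hc⟩ := hY e.proj
  refine (exists_isMIntegralCurve_iff_exists_isMIntegralCurveOn_Ioo hZs e).2 fun T => ?_
  obtain ⟨ε, hε, hcε⟩ := hZ.exists_hasIntegralCurve_compact hZs
    (isCompact_Icc.image hc.continuous : IsCompact (c '' Set.Icc (-|T|) |T|))
  have hcurve : HasIntegralCurve Z e |T| := by
    refine hasIntegralCurve_of_uniform hZs hε
      (hcε e ⟨0, ⟨neg_nonpos.2 (abs_nonneg T), abs_nonneg T⟩, hc0⟩) fun γ s hγ0 hγ t ht htT => ?_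
    have hproj : IsMIntegralCurveOn (TotalSpace.proj ∘ γ) Y (Set.Ioo (-s) s) :=
      isMIntegralCurveOn_comp_of_related hγ
        (fun t _ => (contMDiff_proj (n := ∞) E).mdifferentiable (by simp) _) fun t _ => hZY _
    have heq : (γ t).proj = c t := isMIntegralCurveOn_Ioo_eqOn_of_contMDiff_boundaryless
      (t₀ := 0) ⟨by linarith [ht.1, ht.2], by linarith [ht.1, ht.2]⟩ hYs hproj
      (hc.isMIntegralCurveOn _) (by rw [Function.comp_apply, hγ0, hc0]) ht
    exact hcε _ ⟨t, abs_le.1 htT, heq.symm⟩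
  exact hcurve.mono (le_abs_self T)

end HomogeneousVectorField

/-! ### Algebra of double vector bundles -/

namespace DoubleVectorBundle

variable {EM : Type*} [NormedAddCommGroup EM] [NormedSpace ℝ EM]
  {M : Type*} [TopologicalSpace M] [ChartedSpace EM M]
  {FA : Type*} [NormedAddCommGroup FA] [NormedSpace ℝ FA]
  {A : M → Type*} [TopologicalSpace (TotalSpace FA A)]
  [∀ m, AddCommGroup (A m)] [∀ m, Module ℝ (A m)] [∀ m, TopologicalSpace (A m)]
  [FiberBundle FA A]
  {FE : Type*} [NormedAddCommGroup FE] [NormedSpace ℝ FE]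
  {E : M → Type*} [TopologicalSpace (TotalSpace FE E)]
  [∀ m, AddCommGroup (E m)] [∀ m, Module ℝ (E m)] [∀ m, TopologicalSpace (E m)]
  [FiberBundle FE E]
  {F₁ : Type*} [NormedAddCommGroup F₁] [NormedSpace ℝ F₁]
  {D₁ : TotalSpace FE E → Type*} [TopologicalSpace (TotalSpace F₁ D₁)]
  [∀ e, AddCommGroup (D₁ e)] [∀ e, Module ℝ (D₁ e)] [∀ e, TopologicalSpace (D₁ e)]
  [FiberBundle F₁ D₁]
  {F₂ : Type*} [NormedAddCommGroup F₂] [NormedSpace ℝ F₂]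
  {D₂ : TotalSpace FA A → Type*} [TopologicalSpace (TotalSpace F₂ D₂)]
  [∀ a, AddCommGroup (D₂ a)] [∀ a, Module ℝ (D₂ a)] [∀ a, TopologicalSpace (D₂ a)]
  [FiberBundle F₂ D₂]
  (𝒟 : DoubleVectorBundle (EM := EM) FA A FE E F₁ D₁ F₂ D₂)
  {m : M} {x x₁ x₂ x₃ : E m} {y : A m}

theorem exists_flip_eq (d : D₁ ⟨m, x⟩) (hd : 𝒟.p ⟨m, x⟩ d = y) :
    ∃ d' : D₂ ⟨m, y⟩, 𝒟.flip ⟨⟨m, x⟩, d⟩ = ⟨⟨m, y⟩, d'⟩ := by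
  have h : (𝒟.flip ⟨⟨m, x⟩, d⟩).proj = ⟨m, y⟩ := hd ▸ 𝒟.proj_flip ⟨m, x⟩ d
  rw [← h]
  exact ⟨_, rfl⟩

theorem exists_flip_symm_eq (d' : D₂ ⟨m, y⟩) (hd : 𝒟.pD ⟨m, y⟩ d' = x) :
    ∃ d : D₁ ⟨m, x⟩, 𝒟.flip ⟨⟨m, x⟩, d⟩ = ⟨⟨m, y⟩, d'⟩ := by
  have h : (𝒟.flip.symm ⟨⟨m, y⟩, d'⟩).proj = ⟨m, x⟩ := hd ▸ 𝒟.proj_flip_symm ⟨m, y⟩ d'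
  rw [← h]
  exact ⟨_, 𝒟.flip.apply_symm_apply _⟩

theorem p_eq_of_flip_eq {d : D₁ ⟨m, x⟩} {d' : D₂ ⟨m, y⟩}
    (h : 𝒟.flip ⟨⟨m, x⟩, d⟩ = ⟨⟨m, y⟩, d'⟩) : 𝒟.p ⟨m, x⟩ d = y := by
  have hproj := 𝒟.proj_flip ⟨m, x⟩ d
  rw [h] at hproj
  exact (TotalSpace.mk_inj.1 hproj).symm

theorem pD_eq_of_flip_eq {d : D₁ ⟨m, x⟩} {d' : D₂ ⟨m, y⟩}
    (h : 𝒟.flip ⟨⟨m, x⟩, d⟩ = ⟨⟨m, y⟩, d'⟩) : 𝒟.pD ⟨m, y⟩ d' = x := by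
  have hproj := 𝒟.proj_flip_symm ⟨m, y⟩ d'
  rw [← h, 𝒟.flip.symm_apply_apply] at hproj
  exact (TotalSpace.mk_inj.1 hproj).symm

theorem contMDiff_p : ContMDiff ((𝓘(ℝ, EM).prod 𝓘(ℝ, FE)).prod 𝓘(ℝ, F₁))
    (𝓘(ℝ, EM).prod 𝓘(ℝ, FA)) ∞
    (fun d : TotalSpace F₁ D₁ => (⟨d.proj.proj, 𝒟.p d.proj d.snd⟩ : TotalSpace FA A)) :=
  ((contMDiff_proj D₂).comp 𝒟.flip.contMDiff).congr fun d => (𝒟.proj_flip d.proj d.snd).symm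

theorem contMDiff_pD : ContMDiff ((𝓘(ℝ, EM).prod 𝓘(ℝ, FA)).prod 𝓘(ℝ, F₂))
    (𝓘(ℝ, EM).prod 𝓘(ℝ, FE)) ∞
    (fun d : TotalSpace F₂ D₂ => (⟨d.proj.proj, 𝒟.pD d.proj d.snd⟩ : TotalSpace FE E)) :=
  ((contMDiff_proj D₁).comp 𝒟.flip.symm.contMDiff).congr fun d =>
    (𝒟.proj_flip_symm d.proj d.snd).symm

variable {𝒟}

theorem sumA_iff {d₁ : D₁ ⟨m, x₁⟩} {d₂ : D₁ ⟨m, x₂⟩} {d : D₁ ⟨m, x₃⟩} :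
    𝒟.SumA ⟨⟨m, x₁⟩, d₁⟩ ⟨⟨m, x₂⟩, d₂⟩ ⟨⟨m, x₃⟩, d⟩ ↔
      ∃ (y : A m) (u v : D₂ ⟨m, y⟩), 𝒟.flip ⟨⟨m, x₁⟩, d₁⟩ = ⟨⟨m, y⟩, u⟩ ∧
        𝒟.flip ⟨⟨m, x₂⟩, d₂⟩ = ⟨⟨m, y⟩, v⟩ ∧ 𝒟.flip ⟨⟨m, x₃⟩, d⟩ = ⟨⟨m, y⟩, u + v⟩ := by
  refine ⟨fun ⟨a, u, v, hu, hv, hw⟩ => ?_, fun ⟨y, u, v, hu, hv, hw⟩ => ⟨_, u, v, hu, hv, hw⟩⟩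
  obtain rfl : a = ⟨m, 𝒟.p ⟨m, x₁⟩ d₁⟩ := by rw [← 𝒟.proj_flip ⟨m, x₁⟩ d₁, hu]
  exact ⟨_, u, v, hu, hv, hw⟩

theorem SumA.p_left {d₁ : D₁ ⟨m, x₁⟩} {d₂ : D₁ ⟨m, x₂⟩} {d : D₁ ⟨m, x₃⟩}
    (h : 𝒟.SumA ⟨⟨m, x₁⟩, d₁⟩ ⟨⟨m, x₂⟩, d₂⟩ ⟨⟨m, x₃⟩, d⟩) : 𝒟.p ⟨m, x₁⟩ d₁ = 𝒟.p ⟨m, x₃⟩ d := by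
  obtain ⟨y, u, v, hu, -, hw⟩ := sumA_iff.1 h
  rw [𝒟.p_eq_of_flip_eq hu, 𝒟.p_eq_of_flip_eq hw]

theorem SumA.p_right {d₁ : D₁ ⟨m, x₁⟩} {d₂ : D₁ ⟨m, x₂⟩} {d : D₁ ⟨m, x₃⟩}
    (h : 𝒟.SumA ⟨⟨m, x₁⟩, d₁⟩ ⟨⟨m, x₂⟩, d₂⟩ ⟨⟨m, x₃⟩, d⟩) : 𝒟.p ⟨m, x₂⟩ d₂ = 𝒟.p ⟨m, x₃⟩ d := by
  obtain ⟨y, u, v, -, hv, hw⟩ := sumA_iff.1 h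
  rw [𝒟.p_eq_of_flip_eq hv, 𝒟.p_eq_of_flip_eq hw]

theorem SumA.base_add {d₁ : D₁ ⟨m, x₁⟩} {d₂ : D₁ ⟨m, x₂⟩} {d : D₁ ⟨m, x₃⟩}
    (h : 𝒟.SumA ⟨⟨m, x₁⟩, d₁⟩ ⟨⟨m, x₂⟩, d₂⟩ ⟨⟨m, x₃⟩, d⟩) : x₁ + x₂ = x₃ := by
  obtain ⟨y, u, v, hu, hv, hw⟩ := sumA_iff.1 h
  rw [← 𝒟.pD_eq_of_flip_eq hu, ← 𝒟.pD_eq_of_flip_eq hv, ← 𝒟.pD_eq_of_flip_eq hw, map_add]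

variable (𝒟) in
theorem exists_sumA (d₁ : D₁ ⟨m, x₁⟩) (d₂ : D₁ ⟨m, x₂⟩)
    (h : 𝒟.p ⟨m, x₁⟩ d₁ = 𝒟.p ⟨m, x₂⟩ d₂) (hx : x₁ + x₂ = x₃) :
    ∃ d : D₁ ⟨m, x₃⟩, 𝒟.SumA ⟨⟨m, x₁⟩, d₁⟩ ⟨⟨m, x₂⟩, d₂⟩ ⟨⟨m, x₃⟩, d⟩ := by
  obtain ⟨u, hu⟩ := 𝒟.exists_flip_eq d₁ h
  obtain ⟨v, hv⟩ := 𝒟.exists_flip_eq d₂ rfl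
  have huv : 𝒟.pD _ (u + v) = x₃ := by
    rw [map_add, 𝒟.pD_eq_of_flip_eq hu, 𝒟.pD_eq_of_flip_eq hv, hx]
  obtain ⟨d, hd⟩ := 𝒟.exists_flip_symm_eq (u + v) huv
  exact ⟨d, _, u, v, hu, hv, hd⟩

variable (𝒟) in
theorem exists_sumA_left (d₁ : D₁ ⟨m, x₁⟩) (d : D₁ ⟨m, x₃⟩)
    (h : 𝒟.p ⟨m, x₁⟩ d₁ = 𝒟.p ⟨m, x₃⟩ d) (hx : x₁ + x₂ = x₃) :
    ∃ d₂ : D₁ ⟨m, x₂⟩, 𝒟.SumA ⟨⟨m, x₁⟩, d₁⟩ ⟨⟨m, x₂⟩, d₂⟩ ⟨⟨m, x₃⟩, d⟩ := by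
  obtain ⟨u, hu⟩ := 𝒟.exists_flip_eq d₁ h
  obtain ⟨w, hw⟩ := 𝒟.exists_flip_eq d rfl
  have hwu : 𝒟.pD _ (w - u) = x₂ := by
    rw [map_sub, 𝒟.pD_eq_of_flip_eq hu, 𝒟.pD_eq_of_flip_eq hw]
    exact sub_eq_of_eq_add' hx.symm
  obtain ⟨d₂, hd₂⟩ := 𝒟.exists_flip_symm_eq (w - u) hwu
  exact ⟨d₂, _, u, w - u, hu, hd₂, by rw [hw, add_sub_cancel]⟩

theorem SumA.unique {d₁ d₂ d d' : TotalSpace F₁ D₁} (h : 𝒟.SumA d₁ d₂ d)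
    (h' : 𝒟.SumA d₁ d₂ d') : d = d' := by
  obtain ⟨a, u, v, hu, hv, hw⟩ := h
  obtain ⟨a', u', v', hu', hv', hw'⟩ := h'
  obtain ⟨rfl, huu'⟩ := TotalSpace.mk.inj (hu.symm.trans hu')
  obtain rfl := eq_of_heq huu'
  obtain rfl := TotalSpace.mk_inj.1 (hv.symm.trans hv')
  exact 𝒟.flip.injective (hw.trans hw'.symm)

theorem SumA.unique_right {d₁ d₂ d₂' d : TotalSpace F₁ D₁} (h : 𝒟.SumA d₁ d₂ d)
    (h' : 𝒟.SumA d₁ d₂' d) : d₂ = d₂' := by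
  obtain ⟨a, u, v, hu, hv, hw⟩ := h
  obtain ⟨a', u', v', hu', hv', hw'⟩ := h'
  obtain ⟨rfl, huu'⟩ := TotalSpace.mk.inj (hu.symm.trans hu')
  obtain rfl := eq_of_heq huu'
  obtain rfl := add_left_cancel (TotalSpace.mk_inj.1 (hw.symm.trans hw'))
  exact 𝒟.flip.injective (hv.trans hv'.symm)

theorem SumA.add {d₁ d₁' : D₁ ⟨m, x₁⟩} {d₂ d₂' : D₁ ⟨m, x₂⟩} {d d' : D₁ ⟨m, x₃⟩}
    (h : 𝒟.SumA ⟨⟨m, x₁⟩, d₁⟩ ⟨⟨m, x₂⟩, d₂⟩ ⟨⟨m, x₃⟩, d⟩)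
    (h' : 𝒟.SumA ⟨⟨m, x₁⟩, d₁'⟩ ⟨⟨m, x₂⟩, d₂'⟩ ⟨⟨m, x₃⟩, d'⟩) :
    𝒟.SumA ⟨⟨m, x₁⟩, d₁ + d₁'⟩ ⟨⟨m, x₂⟩, d₂ + d₂'⟩ ⟨⟨m, x₃⟩, d + d'⟩ :=
  𝒟.interchange _ _ _ _ _ _ _ _ _ h h' ⟨_, d₁, d₁', rfl, rfl, rfl⟩ ⟨_, d₂, d₂', rfl, rfl, rfl⟩
    ⟨_, d, d', rfl, rfl, rfl⟩

variable (𝒟) in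
theorem sumA_zero (hx : x₁ + x₂ = x₃) :
    𝒟.SumA ⟨⟨m, x₁⟩, 0⟩ ⟨⟨m, x₂⟩, 0⟩ ⟨⟨m, x₃⟩, 0⟩ := by
  obtain ⟨d, hd⟩ := 𝒟.exists_sumA (x₁ := x₁) (x₂ := x₂) (x₃ := x₃) 0 0
    (by rw [map_zero, map_zero]) hx
  have hdd := hd.add hd
  rw [add_zero, add_zero] at hdd
  have hd0 : d = 0 := add_eq_right.1 (TotalSpace.mk_inj.1 (hdd.unique hd))
  rwa [hd0] at hd

variable (𝒟) in
theorem exists_smulA (t : ℝ) (d : D₁ ⟨m, x⟩) :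
    ∃ d' : D₁ ⟨m, t • x⟩, 𝒟.smulA t ⟨⟨m, x⟩, d⟩ = ⟨⟨m, t • x⟩, d'⟩ ∧
      𝒟.p ⟨m, t • x⟩ d' = 𝒟.p ⟨m, x⟩ d := by
  obtain ⟨u, hu⟩ := 𝒟.exists_flip_eq d rfl
  have htu : 𝒟.pD _ (t • u) = t • x := by rw [map_smul, 𝒟.pD_eq_of_flip_eq hu]
  obtain ⟨d', hd'⟩ := 𝒟.exists_flip_symm_eq (t • u) htu
  refine ⟨d', 𝒟.flip.injective ?_, 𝒟.p_eq_of_flip_eq hd'⟩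
  exact (𝒟.flip.apply_symm_apply _).trans ((congrArg (fibreSMul t) hu).trans hd'.symm)

theorem smulA_add {t : ℝ} {d₁ d₂ : D₁ ⟨m, x⟩} {d₁' d₂' : D₁ ⟨m, x₁⟩}
    (h₁ : 𝒟.smulA t ⟨⟨m, x⟩, d₁⟩ = ⟨⟨m, x₁⟩, d₁'⟩)
    (h₂ : 𝒟.smulA t ⟨⟨m, x⟩, d₂⟩ = ⟨⟨m, x₁⟩, d₂'⟩) :
    𝒟.smulA t ⟨⟨m, x⟩, d₁ + d₂⟩ = ⟨⟨m, x₁⟩, d₁' + d₂'⟩ := by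
  have h : FibreSum (𝒟.smulA t ⟨⟨m, x⟩, d₁⟩) (𝒟.smulA t ⟨⟨m, x⟩, d₂⟩)
      (𝒟.smulA t ⟨⟨m, x⟩, d₁ + d₂⟩) :=
    𝒟.smul_interchange t _ _ _ ⟨_, d₁, d₂, rfl, rfl, rfl⟩
  rw [h₁, h₂] at h
  obtain ⟨e, u, v, hu, hv, hw⟩ := h
  obtain ⟨rfl, hu'⟩ := TotalSpace.mk.inj hu
  obtain rfl := eq_of_heq hu'
  obtain rfl := TotalSpace.mk_inj.1 hv
  exact hw

variable (𝒟) in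
theorem exists_sumA_coreIncl (e : TotalSpace FE E) (c : 𝒟.Core e.proj) :
    ∃ d : D₁ e, 𝒟.SumA ⟨e, 0⟩ (𝒟.coreIncl e.proj c) ⟨e, d⟩ :=
  𝒟.exists_sumA (0 : D₁ ⟨e.proj, e.snd⟩) (c : D₁ ⟨e.proj, 0⟩)
    ((map_zero _).trans (LinearMap.mem_ker.1 c.2).symm) (add_zero e.snd)

theorem p_eq_zero_of_isCoreSection {X : Cₛ^∞⟮𝓘(ℝ, EM).prod 𝓘(ℝ, FE); F₁, D₁⟯}
    (hX : 𝒟.IsCoreSection X) (e : TotalSpace FE E) : 𝒟.p e (X e) = 0 :=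
  have ⟨_, _, hc⟩ := hX
  (hc e).p_left.symm.trans (map_zero _)

section Smoothness

variable [VectorBundle ℝ F₂ D₂]
  {EQ : Type*} [NormedAddCommGroup EQ] [NormedSpace ℝ EQ]
  {HQ : Type*} [TopologicalSpace HQ] {IQ : ModelWithCorners ℝ EQ HQ}
  {Q : Type*} [TopologicalSpace Q] [ChartedSpace HQ Q] {f g h : Q → TotalSpace F₁ D₁} {q₀ : Q}

theorem contMDiffAt_sumA
    (hf : ContMDiffAt IQ ((𝓘(ℝ, EM).prod 𝓘(ℝ, FE)).prod 𝓘(ℝ, F₁)) ∞ f q₀)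
    (hg : ContMDiffAt IQ ((𝓘(ℝ, EM).prod 𝓘(ℝ, FE)).prod 𝓘(ℝ, F₁)) ∞ g q₀)
    (hs : ∀ q, 𝒟.SumA (f q) (g q) (h q)) :
    ContMDiffAt IQ ((𝓘(ℝ, EM).prod 𝓘(ℝ, FE)).prod 𝓘(ℝ, F₁)) ∞ h q₀ := by
  have hflip := contMDiffAt_fibreSum (h := 𝒟.flip ∘ h)
    (𝒟.flip.contMDiff.contMDiffAt.comp q₀ hf) (𝒟.flip.contMDiff.contMDiffAt.comp q₀ hg) hs
  simpa only [Function.comp_def, 𝒟.flip.symm_apply_apply] using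
    𝒟.flip.symm.contMDiff.contMDiffAt.comp q₀ hflip

variable (𝒟) in
theorem contMDiff_smulA (t : ℝ) : ContMDiff ((𝓘(ℝ, EM).prod 𝓘(ℝ, FE)).prod 𝓘(ℝ, F₁))
    ((𝓘(ℝ, EM).prod 𝓘(ℝ, FE)).prod 𝓘(ℝ, F₁)) ∞ (𝒟.smulA t) :=
  𝒟.flip.symm.contMDiff.comp ((contMDiff_fibreSMul t).comp 𝒟.flip.contMDiff)

end Smoothness

section Surjectivity

variable (𝒟) [VectorBundle ℝ FA A] [VectorBundle ℝ FE E]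
  [ContMDiffVectorBundle ∞ FE E 𝓘(ℝ, EM)] [FiniteDimensional ℝ FE] [VectorBundle ℝ F₂ D₂]
  [FiniteDimensional ℝ F₂] [ContMDiffVectorBundle ∞ F₂ D₂ (𝓘(ℝ, EM).prod 𝓘(ℝ, FA))]

-- `p_D` is onto over the zero section of `A`, hence over a neighbourhood of it, and some multiple
-- `t • y` with `t ≠ 0` lies in that neighbourhood.
theorem exists_p_eq (x : E m) (y : A m) : ∃ d : D₁ ⟨m, x⟩, 𝒟.p ⟨m, x⟩ d = y := by
  have hsurj : Function.Surjective (𝒟.pD ⟨m, 0⟩) := fun x =>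
    have ⟨d', hd'⟩ := 𝒟.exists_flip_eq (0 : D₁ ⟨m, x⟩) (map_zero _)
    ⟨d', 𝒟.pD_eq_of_flip_eq hd'⟩
  obtain ⟨σ, hσ, -⟩ := exists_localSplitting (z := fun a => a) 𝒟.contMDiff_pD isOpen_univ
    contMDiffOn_id (Set.mem_univ _) hsurj
    (FiberBundle.mem_baseSet_trivializationAt F₂ D₂ _)
    (FiberBundle.mem_baseSet_trivializationAt FE E m)
  obtain ⟨U, hU, hUσ⟩ := exists_fibreSMul_mem_nhds (σ.isOpen_source.mem_nhds hσ)
  obtain ⟨t, ht, hty⟩ := hUσ ⟨m, y⟩ (mem_of_mem_nhds hU)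
  obtain ⟨d, hd⟩ := 𝒟.exists_flip_symm_eq _ (LocalSplitting.map_lift hty x)
  exact ⟨t⁻¹ • d, by rw [map_smul, 𝒟.p_eq_of_flip_eq hd, inv_smul_smul₀ ht]⟩

theorem p_surjective (e : TotalSpace FE E) : Function.Surjective (𝒟.p e) :=
  fun y => 𝒟.exists_p_eq e.snd y

theorem pD_surjective (a : TotalSpace FA A) : Function.Surjective (𝒟.pD a) := fun x =>
  have ⟨d, hd⟩ := 𝒟.exists_p_eq x a.snd
  have ⟨d', hd'⟩ := 𝒟.exists_flip_eq d hd
  ⟨d', 𝒟.pD_eq_of_flip_eq hd'⟩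

end Surjectivity

variable [VectorBundle ℝ F₁ D₁] [VectorBundle ℝ F₂ D₂]

-- Only additivity is assumed: the partial sums of `s • d₁` and `s • d₂` depend additively
-- and continuously on `s`, hence linearly.
theorem SumA.smul {d₁ : D₁ ⟨m, x₁⟩} {d₂ : D₁ ⟨m, x₂⟩} {d : D₁ ⟨m, x₃⟩}
    (h : 𝒟.SumA ⟨⟨m, x₁⟩, d₁⟩ ⟨⟨m, x₂⟩, d₂⟩ ⟨⟨m, x₃⟩, d⟩) (t : ℝ) :
    𝒟.SumA ⟨⟨m, x₁⟩, t • d₁⟩ ⟨⟨m, x₂⟩, t • d₂⟩ ⟨⟨m, x₃⟩, t • d⟩ := by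
  have hp (s : ℝ) : 𝒟.p ⟨m, x₁⟩ (s • d₁) = 𝒟.p ⟨m, x₂⟩ (s • d₂) := by
    rw [map_smul, map_smul, h.p_left, h.p_right]
  choose g hg using fun s : ℝ => 𝒟.exists_sumA (s • d₁) (s • d₂) (hp s) h.base_add
  have hadd (s s' : ℝ) : g (s + s') = g s + g s' := by
    have hsum := (hg s).add (hg s')
    rw [← add_smul, ← add_smul] at hsum
    exact TotalSpace.mk_inj.1 ((hg (s + s')).unique hsum)
  have hcont : ContMDiff 𝓘(ℝ, ℝ) ((𝓘(ℝ, EM).prod 𝓘(ℝ, FE)).prod 𝓘(ℝ, F₁)) ∞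
      fun s => (⟨⟨m, x₃⟩, g s⟩ : TotalSpace F₁ D₁) := fun s =>
    contMDiffAt_sumA (contMDiff_fibreSMul_left ⟨_, d₁⟩ s)
      (contMDiff_fibreSMul_left ⟨_, d₂⟩ s) hg
  have hg1 : g 1 = d := by
    have h1 := hg 1
    rw [one_smul, one_smul] at h1
    exact TotalSpace.mk_inj.1 (h1.unique h)
  have hgt : g t = t • g 1 :=
    map_real_smul_of_continuous_totalSpace (AddMonoidHom.mk' g hadd) hcont.continuous t
  have ht := hg t
  rwa [hgt, hg1] at ht

theorem smulA_smul {t : ℝ} {d : D₁ ⟨m, x⟩} {d' : D₁ ⟨m, t • x⟩}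
    (h : 𝒟.smulA t ⟨⟨m, x⟩, d⟩ = ⟨⟨m, t • x⟩, d'⟩) (s : ℝ) :
    𝒟.smulA t ⟨⟨m, x⟩, s • d⟩ = ⟨⟨m, t • x⟩, s • d'⟩ := by
  choose g hg _ using fun s : ℝ => 𝒟.exists_smulA t (s • d)
  have hadd (s s' : ℝ) : g (s + s') = g s + g s' := by
    have hsum := smulA_add (hg s) (hg s')
    rw [← add_smul, hg] at hsum
    exact TotalSpace.mk_inj.1 hsum
  have hcont : Continuous fun s => (⟨⟨m, t • x⟩, g s⟩ : TotalSpace F₁ D₁) :=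
    ((𝒟.contMDiff_smulA t).continuous.comp (continuous_fibreSMul_left ⟨_, d⟩)).congr hg
  have hg1 : g 1 = d' := by
    have h1 := hg 1
    rw [one_smul, h] at h1
    exact (TotalSpace.mk_inj.1 h1).symm
  have hgs : g s = s • g 1 :=
    map_real_smul_of_continuous_totalSpace (AddMonoidHom.mk' g hadd) hcont s
  rw [hg, hgs, hg1]

variable (𝒟 m) in
/-- The families `(d_x)` of elements of `D`, indexed by `x ∈ E_m`, which are linear for the vector
bundle structure over `A`: the values on a fibre of `E` of a linear section of `D → E`. -/
def linearFamilies : Submodule ℝ ((x : E m) → D₁ ⟨m, x⟩) where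
  carrier := {X |
    (∀ x₁ x₂, 𝒟.SumA ⟨⟨m, x₁⟩, X x₁⟩ ⟨⟨m, x₂⟩, X x₂⟩ ⟨⟨m, x₁ + x₂⟩, X (x₁ + x₂)⟩) ∧
    ∀ (t : ℝ) x, 𝒟.smulA t ⟨⟨m, x⟩, X x⟩ = ⟨⟨m, t • x⟩, X (t • x)⟩}
  add_mem' h h' := ⟨fun x₁ x₂ => (h.1 x₁ x₂).add (h'.1 x₁ x₂),
    fun t x => smulA_add (h.2 t x) (h'.2 t x)⟩
  zero_mem' := ⟨fun _ _ => 𝒟.sumA_zero rfl, fun t x => by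
    obtain ⟨d', hd', -⟩ := 𝒟.exists_smulA t (0 : D₁ ⟨m, x⟩)
    have h0 := smulA_smul hd' 0
    rwa [smul_zero, zero_smul] at h0⟩
  smul_mem' s _ h := ⟨fun x₁ x₂ => (h.1 x₁ x₂).smul s, fun t x => smulA_smul (h.2 t x) s⟩

theorem isLinearSection_iff {X : Cₛ^∞⟮𝓘(ℝ, EM).prod 𝓘(ℝ, FE); F₁, D₁⟯}
    {a : Cₛ^∞⟮𝓘(ℝ, EM); FA, A⟯} :
    𝒟.IsLinearSection X a ↔
      (∀ m x, 𝒟.p ⟨m, x⟩ (X ⟨m, x⟩) = a m) ∧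
        ∀ m, (fun x => X ⟨m, x⟩) ∈ 𝒟.linearFamilies m := by
  constructor
  · exact fun h => ⟨fun m x => h.covers ⟨m, x⟩, fun m =>
      ⟨fun x₁ x₂ => h.map_add _ _ _ ⟨m, x₁, x₂, rfl, rfl, rfl⟩,
        fun t x => (h.map_smul t ⟨m, x⟩).symm⟩⟩
  · rintro ⟨hp, hlin⟩
    refine ⟨fun e => hp e.1 e.2, ?_, fun t e => ((hlin e.1).2 t e.2).symm⟩
    rintro _ _ _ ⟨m, x₁, x₂, rfl, rfl, rfl⟩
    exact (hlin m).1 x₁ x₂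

/-! ### Linear lifts -/

variable (𝒟) in
/-- The splittings over `m` of `D → E ×_M A` which are linear in both arguments. -/
def linearLifts (m : M) : Set ((x : E m) → A m →ₗ[ℝ] D₁ ⟨m, x⟩) :=
  {θ | (∀ x y, 𝒟.p ⟨m, x⟩ (θ x y) = y) ∧ ∀ y, (fun x => θ x y) ∈ 𝒟.linearFamilies m}

theorem convex_linearLifts (m : M) : Convex ℝ (𝒟.linearLifts m) := by
  rintro θ ⟨hpθ, hθ⟩ θ' ⟨hpθ', hθ'⟩ s t - - hst
  refine ⟨fun x y => ?_, fun y => (𝒟.linearFamilies m).add_mem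
    ((𝒟.linearFamilies m).smul_mem s (hθ y)) ((𝒟.linearFamilies m).smul_mem t (hθ' y))⟩
  change 𝒟.p ⟨m, x⟩ (s • θ x y + t • θ' x y) = y
  rw [map_add, map_smul, map_smul, hpθ, hpθ', ← add_smul, hst, one_smul]

variable (𝒟) in
/-- `θ` is a smooth lift `(e, a) ↦ θ e a` of `E ×_M A` to `D` over `U`, linear in both arguments.
Smoothness is tested on the sections of `A`. -/
structure IsLinearLiftOn (θ : (e : TotalSpace FE E) → A e.proj →ₗ[ℝ] D₁ e) (U : Set M) : Prop where
  mem_linearLifts : ∀ m ∈ U, (fun x => θ ⟨m, x⟩) ∈ 𝒟.linearLifts m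
  contMDiffAt : ∀ (a : (m : M) → A m) (e : TotalSpace FE E), e.proj ∈ U →
    ContMDiffAt 𝓘(ℝ, EM) (𝓘(ℝ, EM).prod 𝓘(ℝ, FA)) ∞ (fun m => (⟨m, a m⟩ : TotalSpace FA A)) e.proj →
    ContMDiffAt (𝓘(ℝ, EM).prod 𝓘(ℝ, FE)) ((𝓘(ℝ, EM).prod 𝓘(ℝ, FE)).prod 𝓘(ℝ, F₁)) ∞
      (fun e => (⟨e, θ e (a e.proj)⟩ : TotalSpace F₁ D₁)) e

namespace IsLinearLiftOn

variable {θ : (e : TotalSpace FE E) → A e.proj →ₗ[ℝ] D₁ e} (hθ : 𝒟.IsLinearLiftOn θ Set.univ)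
include hθ

theorem p_apply (e : TotalSpace FE E) (y : A e.proj) : 𝒟.p e (θ e y) = y :=
  (hθ.mem_linearLifts e.proj (Set.mem_univ _)).1 e.snd y

theorem isCompl (e : TotalSpace FE E) :
    IsCompl (LinearMap.ker (𝒟.p e)) (LinearMap.range (θ e)) := by
  refine IsCompl.of_le ?_ fun d _ => ?_
  · rintro _ ⟨hd, y, rfl⟩
    have hy : y = 0 := (hθ.p_apply e y).symm.trans hd
    rw [hy, map_zero, Submodule.mem_bot]
  · rw [← sub_add_cancel d (θ e (𝒟.p e d))]
    refine Submodule.add_mem_sup ?_ ⟨_, rfl⟩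
    rw [LinearMap.mem_ker, map_sub, hθ.p_apply, sub_self]

variable [VectorBundle ℝ FA A] [FiniteDimensional ℝ FA] [ContMDiffVectorBundle ∞ FA A 𝓘(ℝ, EM)]

theorem isSmoothSubbundle :
    IsSmoothSubbundle (𝓘(ℝ, EM).prod 𝓘(ℝ, FE)) F₁ fun e => LinearMap.range (θ e) := by
  intro e₀
  let eA := trivializationAt FA A e₀.proj
  let b := Module.finBasis ℝ FA
  have hb := eA.isLocalFrameOn_localFrame_baseSet 𝓘(ℝ, EM) ∞ b
  refine ⟨TotalSpace.proj ⁻¹' eA.baseSet,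
    eA.open_baseSet.preimage (FiberBundle.continuous_proj FE E),
    FiberBundle.mem_baseSet_trivializationAt FA A e₀.proj, _,
    fun i e => θ e (eA.localFrame b i e.proj), fun i e he => ?_, fun e he => ⟨?_, ?_⟩⟩
  · exact (hθ.contMDiffAt _ e (Set.mem_univ _)
      (contMDiffAt_localFrame_of_mem ∞ eA b i he)).contMDiffWithinAt
  · exact (hb.linearIndependent he).map'
      (θ e) (LinearMap.ker_eq_bot.2 (Function.LeftInverse.injective (hθ.p_apply e)))
  · change _ = LinearMap.range (θ e)
    rw [Set.range_comp' (θ e), ← Submodule.map_span, LinearMap.range_eq_map]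
    exact congrArg _ (top_le_iff.1 (hb.generating he))

/-- The Ehresmann connection whose horizontal spaces are the images of a linear lift. -/
def connection : EhresmannConnection (𝓘(ℝ, EM).prod 𝓘(ℝ, FE)) F₁
    (TotalSpace.proj : TotalSpace FE E → M) 𝒟.p where
  H e := LinearMap.range (θ e)
  isSmoothSubbundle := hθ.isSmoothSubbundle
  isCompl := hθ.isCompl

theorem isLinearConnection : 𝒟.IsLinearConnection hθ.connection := fun a =>
  ⟨⟨fun e => θ e (a e.proj), fun e => hθ.contMDiffAt a e (Set.mem_univ _) (a.contMDiff _)⟩,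
    ⟨fun _ => ⟨_, rfl⟩, fun e => hθ.p_apply e _⟩,
    isLinearSection_iff.2 ⟨fun m x => hθ.p_apply ⟨m, x⟩ _,
      fun m => (hθ.mem_linearLifts m (Set.mem_univ _)).2 (a m)⟩⟩

end IsLinearLiftOn

section Existence

variable [VectorBundle ℝ FA A] [VectorBundle ℝ FE E]
  [ContMDiffVectorBundle ∞ FE E 𝓘(ℝ, EM)] [FiniteDimensional ℝ FE] [FiniteDimensional ℝ F₂]
  [ContMDiffVectorBundle ∞ F₂ D₂ (𝓘(ℝ, EM).prod 𝓘(ℝ, FA))]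

variable (𝒟) in
theorem exists_local_linear_section {a : (m : M) → A m} {U₀ : Set M} (hU₀ : IsOpen U₀)
    (ha : ContMDiffOn 𝓘(ℝ, EM) (𝓘(ℝ, EM).prod 𝓘(ℝ, FA)) ∞
      (fun m => (⟨m, a m⟩ : TotalSpace FA A)) U₀) {m₀ : M} (hm₀ : m₀ ∈ U₀) :
    ∃ U ⊆ U₀, IsOpen U ∧ m₀ ∈ U ∧ ∃ X : (e : TotalSpace FE E) → D₁ e,
      (∀ e : TotalSpace FE E, e.proj ∈ U →
        ContMDiffAt (𝓘(ℝ, EM).prod 𝓘(ℝ, FE)) ((𝓘(ℝ, EM).prod 𝓘(ℝ, FE)).prod 𝓘(ℝ, F₁)) ∞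
          (fun e => (⟨e, X e⟩ : TotalSpace F₁ D₁)) e) ∧
      ∀ m ∈ U, (∀ x, 𝒟.p ⟨m, x⟩ (X ⟨m, x⟩) = a m) ∧
        (fun x => X ⟨m, x⟩) ∈ 𝒟.linearFamilies m := by
  classical
  let z : M → TotalSpace FA A := fun m => ⟨m, a m⟩
  obtain ⟨σ, hmσ, hσ⟩ := exists_localSplitting (z := z) 𝒟.contMDiff_pD hU₀ ha hm₀
    (𝒟.pD_surjective _) (FiberBundle.mem_baseSet_trivializationAt F₂ D₂ _)
    (FiberBundle.mem_baseSet_trivializationAt FE E m₀)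
  have hX (e : TotalSpace FE E) : ∃ d : D₁ e, e.proj ∈ σ.source →
      𝒟.flip ⟨e, d⟩ = ⟨z e.proj, σ.lift e.proj e.snd⟩ := by
    by_cases hm : e.proj ∈ σ.source
    · obtain ⟨d, hd⟩ := 𝒟.exists_flip_symm_eq _ (LocalSplitting.map_lift hm e.snd)
      exact ⟨d, fun _ => hd⟩
    · exact ⟨0, fun h => absurd h hm⟩
  choose X hX using hX
  refine ⟨σ.source, hσ, σ.isOpen_source, hmσ, X, fun e he => ?_, fun m hm => ⟨fun x => ?_, ?_, ?_⟩⟩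
  · have hproj : ContMDiffAt (𝓘(ℝ, EM).prod 𝓘(ℝ, FE)) 𝓘(ℝ, EM) ∞
      (TotalSpace.proj : TotalSpace FE E → M) e := contMDiffAt_proj E
    have hza : ContMDiffAt 𝓘(ℝ, EM) (𝓘(ℝ, EM).prod 𝓘(ℝ, FA)) ∞ z e.proj :=
      ha.contMDiffAt (hU₀.mem_nhds (hσ he))
    have hlift := LocalSplitting.contMDiffAt_lift (σ := σ) hproj he (hza.comp e hproj)
      (w := fun e => e.snd) contMDiffAt_id
    refine (𝒟.flip.symm.contMDiff.contMDiffAt.comp e hlift).congr_of_eventuallyEq ?_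
    filter_upwards [(σ.isOpen_source.preimage (FiberBundle.continuous_proj FE E)).mem_nhds he]
      with e' he'
    exact 𝒟.flip.eq_symm_apply.2 (hX e' he')
  · exact 𝒟.p_eq_of_flip_eq (hX ⟨m, x⟩ hm)
  · exact fun x₁ x₂ => ⟨_, _, _, hX ⟨m, x₁⟩ hm, hX ⟨m, x₂⟩ hm,
      by rw [hX ⟨m, x₁ + x₂⟩ hm, map_add]⟩
  · intro t x
    refine (congrArg (𝒟.flip.symm ∘ fibreSMul t) (hX ⟨m, x⟩ hm)).trans ?_
    rw [𝒟.flip.eq_symm_apply.2 (hX ⟨m, t • x⟩ hm), map_smul]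
    rfl

variable [FiniteDimensional ℝ FA] [ContMDiffVectorBundle ∞ FA A 𝓘(ℝ, EM)]

variable (𝒟) in
theorem exists_isLinearLiftOn_nhds (m₀ : M) :
    ∃ U, IsOpen U ∧ m₀ ∈ U ∧ ∃ θ, 𝒟.IsLinearLiftOn θ U := by
  classical
  let eA := trivializationAt FA A m₀
  have hm₀ : m₀ ∈ eA.baseSet := FiberBundle.mem_baseSet_trivializationAt FA A m₀
  let b := Module.finBasis ℝ FA
  choose U _ hU hmU X hXs hX using fun i => 𝒟.exists_local_linear_section eA.open_baseSet
    (eA.contMDiffOn_localFrame_baseSet ∞ b i) hm₀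
  have hUi {m : M} (hm : m ∈ eA.baseSet ∩ ⋂ i, U i) (i) : m ∈ U i := Set.mem_iInter.1 hm.2 i
  refine ⟨eA.baseSet ∩ ⋂ i, U i, eA.open_baseSet.inter (isOpen_iInter_of_finite hU),
    ⟨hm₀, Set.mem_iInter.2 hmU⟩,
    fun e => ∑ i, (eA.localFrameCoeff 𝓘(ℝ, EM) b i e.proj).smulRight (X i e),
    fun m hm => ⟨fun x y => ?_, fun y => ?_⟩, fun a e he ha => ?_⟩
  · simp only [LinearMap.sum_apply, LinearMap.smulRight_apply, map_sum, map_smul,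
      (hX _ m (hUi hm _)).1 x]
    have hy := eA.eq_sum_localFrameCoeff_smul (I := 𝓘(ℝ, EM)) (b := b)
      (s := Function.update 0 m y) hm.1
    rw [Function.update_self] at hy
    exact hy.symm
  · have hsum : (fun x => (∑ i, (eA.localFrameCoeff 𝓘(ℝ, EM) b i m).smulRight (X i ⟨m, x⟩)) y) =
        ∑ i, eA.localFrameCoeff 𝓘(ℝ, EM) b i m y • fun x => X i ⟨m, x⟩ := by
      ext x
      simp only [LinearMap.sum_apply, LinearMap.smulRight_apply, Finset.sum_apply, Pi.smul_apply]
    exact hsum ▸ Submodule.sum_mem _ fun i _ => Submodule.smul_mem _ _ (hX i m (hUi hm i)).2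
  · simp only [LinearMap.sum_apply, LinearMap.smulRight_apply]
    exact ContMDiffAt.sum_section fun i _ => ContMDiffAt.smul_section
      ((contMDiffAt_localFrameCoeff b he.1 ha i).comp e (contMDiffAt_proj E)) (hXs i e (hUi he i))

variable (𝒟) in
theorem exists_isLinearLiftOn_univ [IsManifold 𝓘(ℝ, EM) ∞ M] [FiniteDimensional ℝ EM]
    [T2Space M] [SecondCountableTopology M] : ∃ θ, 𝒟.IsLinearLiftOn θ Set.univ := by
  choose U hU hmU θ hθ using 𝒟.exists_isLinearLiftOn_nhds
  have : LocallyCompactSpace M := ChartedSpace.locallyCompactSpace EM M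
  obtain ⟨ρ, hρ⟩ := SmoothPartitionOfUnity.exists_isSubordinate 𝓘(ℝ, EM) isClosed_univ U hU
    fun m _ => Set.mem_iUnion.2 ⟨m, hmU m⟩
  have hfin (m : M) : (fun i => ρ i m).HasFiniteSupport := ρ.locallyFinite.point_finite m
  refine ⟨fun e => ∑ᶠ i, ρ i e.proj • θ i e, fun m _ => ?_, fun a e _ ha => ?_⟩
  · have hmem := (𝒟.convex_linearLifts m).finsum_mem (fun i => ρ.nonneg i m)
      (ρ.sum_eq_one (Set.mem_univ m)) fun i hi =>
        (hθ i).mem_linearLifts m (hρ i (subset_tsupport _ hi))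
    convert hmem using 1
    ext1 x
    have hsupp : (fun i => ρ i m • fun x => θ i ⟨m, x⟩).HasFiniteSupport := (hfin m).smul_left _
    exact ((Pi.evalAddMonoidHom _ x).map_finsum hsupp).symm
  · have happ (e : TotalSpace FE E) :
        (∑ᶠ i, ρ i e.proj • θ i e) (a e.proj) = ∑ᶠ i, ρ i e.proj • θ i e (a e.proj) :=
      (LinearMap.applyₗ (a e.proj) : (A e.proj →ₗ[ℝ] D₁ e) →ₗ[ℝ] D₁ e).toAddMonoidHom.map_finsum
        ((hfin e.proj).smul_left _)
    simp only [happ]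
    refine ContMDiffAt.finsum_section_of_locallyFinite
      ((ρ.locallyFinite.preimage_continuous (FiberBundle.continuous_proj FE E)).subset
        fun i e he h => he (by rw [h, zero_smul])) fun i => ?_
    refine contMDiffAt_fibreSMul_of_mem_tsupport
      (f := fun e => (⟨e, θ i e (a e.proj)⟩ : TotalSpace F₁ D₁))
      ((ρ i).contMDiff.contMDiffAt.comp e (contMDiffAt_proj E)) contMDiffAt_id fun hi => ?_
    exact (hθ i).contMDiffAt a e
      (hρ i (tsupport_comp_subset_preimage _ (FiberBundle.continuous_proj FE E) hi)) ha

end Existence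

/-! ### The core and the kernel of `p` -/

variable (𝒟) in
/-- The linear map `c ↦ 0_e +_A c̄` from the core to the fibre of `D → E` over `e`. -/
noncomputable def kernelIncl (e : TotalSpace FE E) : 𝒟.Core e.proj →ₗ[ℝ] D₁ e where
  toFun c := (𝒟.exists_sumA_coreIncl e c).choose
  map_add' c c' := by
    have h := (𝒟.exists_sumA_coreIncl e c).choose_spec.add (𝒟.exists_sumA_coreIncl e c').choose_spec
    rw [add_zero] at h
    exact TotalSpace.mk_inj.1 ((𝒟.exists_sumA_coreIncl e (c + c')).choose_spec.unique h)
  map_smul' t c := by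
    have h := (𝒟.exists_sumA_coreIncl e c).choose_spec.smul t
    rw [smul_zero] at h
    exact TotalSpace.mk_inj.1 ((𝒟.exists_sumA_coreIncl e (t • c)).choose_spec.unique h)

theorem sumA_kernelIncl (e : TotalSpace FE E) (c : 𝒟.Core e.proj) :
    𝒟.SumA ⟨e, 0⟩ (𝒟.coreIncl e.proj c) ⟨e, 𝒟.kernelIncl e c⟩ :=
  (𝒟.exists_sumA_coreIncl e c).choose_spec

theorem kernelIncl_injective (e : TotalSpace FE E) : Function.Injective (𝒟.kernelIncl e) := by
  intro c c' hcc'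
  have h := sumA_kernelIncl e c
  rw [hcc'] at h
  exact Subtype.ext (TotalSpace.mk_inj.1 (h.unique_right (sumA_kernelIncl e c')))

theorem p_kernelIncl (e : TotalSpace FE E) (c : 𝒟.Core e.proj) : 𝒟.p e (𝒟.kernelIncl e c) = 0 :=
  (sumA_kernelIncl e c).p_left.symm.trans (map_zero _)

theorem range_kernelIncl (e : TotalSpace FE E) :
    LinearMap.range (𝒟.kernelIncl e) = LinearMap.ker (𝒟.p e) := by
  refine le_antisymm ?_ fun d hd => ?_
  · rintro _ ⟨c, rfl⟩
    exact p_kernelIncl e c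
  · obtain ⟨m, x⟩ := e
    obtain ⟨c, hc⟩ := 𝒟.exists_sumA_left (x₂ := 0) (0 : D₁ ⟨m, x⟩) d
      ((map_zero _).trans (LinearMap.mem_ker.1 hd).symm) (add_zero x)
    have hcker : 𝒟.p ⟨m, 0⟩ c = 0 := hc.p_right.trans hd
    exact ⟨⟨c, hcker⟩, TotalSpace.mk_inj.1 ((sumA_kernelIncl ⟨m, x⟩ ⟨c, hcker⟩).unique hc)⟩

section Smoothness

variable {EQ : Type*} [NormedAddCommGroup EQ] [NormedSpace ℝ EQ]
  {HQ : Type*} [TopologicalSpace HQ] {IQ : ModelWithCorners ℝ EQ HQ}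
  {Q : Type*} [TopologicalSpace Q] [ChartedSpace HQ Q] {e : Q → TotalSpace FE E}
  {c : (q : Q) → 𝒟.Core (e q).proj} {q₀ : Q}

theorem contMDiffAt_kernelIncl (he : ContMDiffAt IQ (𝓘(ℝ, EM).prod 𝓘(ℝ, FE)) ∞ e q₀)
    (hc : ContMDiffAt IQ ((𝓘(ℝ, EM).prod 𝓘(ℝ, FE)).prod 𝓘(ℝ, F₁)) ∞
      (fun q => 𝒟.coreIncl (e q).proj (c q)) q₀) :
    ContMDiffAt IQ ((𝓘(ℝ, EM).prod 𝓘(ℝ, FE)).prod 𝓘(ℝ, F₁)) ∞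
      (fun q => (⟨e q, 𝒟.kernelIncl (e q) (c q)⟩ : TotalSpace F₁ D₁)) q₀ :=
  contMDiffAt_sumA ((contMDiff_zeroSection ℝ D₁).contMDiffAt.comp q₀ he) hc
    fun q => sumA_kernelIncl (e q) (c q)

theorem contMDiffAt_coreIncl (he : ContMDiffAt IQ (𝓘(ℝ, EM).prod 𝓘(ℝ, FE)) ∞ e q₀)
    (hc : ContMDiffAt IQ ((𝓘(ℝ, EM).prod 𝓘(ℝ, FE)).prod 𝓘(ℝ, F₁)) ∞
      (fun q => (⟨e q, 𝒟.kernelIncl (e q) (c q)⟩ : TotalSpace F₁ D₁)) q₀) :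
    ContMDiffAt IQ ((𝓘(ℝ, EM).prod 𝓘(ℝ, FE)).prod 𝓘(ℝ, F₁)) ∞
      (fun q => 𝒟.coreIncl (e q).proj (c q)) q₀ := by
  have hflip := contMDiffAt_of_fibreSum (f := fun q => 𝒟.flip (𝒟.coreIncl (e q).proj (c q)))
    (𝒟.flip.contMDiff.contMDiffAt.comp q₀ hc)
    (𝒟.flip.contMDiff.contMDiffAt.comp q₀ ((contMDiff_zeroSection ℝ D₁).contMDiffAt.comp q₀ he))
    fun q => FibreSum.symm (sumA_kernelIncl (e q) (c q))
  simpa only [Function.comp_def, 𝒟.flip.symm_apply_apply] using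
    𝒟.flip.symm.contMDiff.contMDiffAt.comp q₀ hflip

end Smoothness

variable (𝒟) in
theorem exists_isKernelIso (k : ℕ) [𝒟.CoreBundle k] : ∃ i, 𝒟.IsKernelIso k i := by
  refine ⟨𝒟.kernelIncl, sumA_kernelIncl, fun x => ?_, kernelIncl_injective, range_kernelIncl⟩
  have hcore := (CoreBundle.contMDiff_coreIncl (𝒟 := 𝒟) (k := k)).comp
    (contMDiff_pullback_lift (V := 𝒟.Core) (F := Fin k → ℝ) (projE EM FE E))
  exact contMDiffAt_kernelIncl (contMDiffAt_proj _) hcore.contMDiffAt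

variable (𝒟) in
/-- The core section defined by a section of the core. -/
noncomputable def coreSection (c : (m : M) → 𝒟.Core m)
    (hc : ContMDiff 𝓘(ℝ, EM) ((𝓘(ℝ, EM).prod 𝓘(ℝ, FE)).prod 𝓘(ℝ, F₁)) ∞
      fun m => 𝒟.coreIncl m (c m)) : Cₛ^∞⟮𝓘(ℝ, EM).prod 𝓘(ℝ, FE); F₁, D₁⟯ :=
  ⟨fun e => 𝒟.kernelIncl e (c e.proj), fun e =>
    contMDiffAt_kernelIncl contMDiffAt_id (hc.contMDiffAt.comp e (contMDiffAt_proj E))⟩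

theorem isCoreSection_coreSection (c : (m : M) → 𝒟.Core m)
    (hc : ContMDiff 𝓘(ℝ, EM) ((𝓘(ℝ, EM).prod 𝓘(ℝ, FE)).prod 𝓘(ℝ, F₁)) ∞
      fun m => 𝒟.coreIncl m (c m)) : 𝒟.IsCoreSection (𝒟.coreSection c hc) :=
  ⟨c, hc, fun e => sumA_kernelIncl e (c e.proj)⟩

variable (𝒟) in
/-- A local trivialization of rank `k` of the core, as a family of subspaces of `D → E` along the
zero section of `E`. -/
abbrev CoreChart (k : ℕ) : Type _ :=
  SubbundleChart (𝓘(ℝ, EM).prod 𝓘(ℝ, FE)) F₁ D₁ 𝓘(ℝ, EM) (fun m => ⟨m, 0⟩)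
    (fun m => LinearMap.ker (𝒟.p ⟨m, 0⟩)) k

section CoreFrames

variable [VectorBundle ℝ FA A] [FiniteDimensional ℝ FA] [ContMDiffVectorBundle ∞ FA A 𝓘(ℝ, EM)]
  [VectorBundle ℝ FE E] [FiniteDimensional ℝ FE] [ContMDiffVectorBundle ∞ FE E 𝓘(ℝ, EM)]
  [FiniteDimensional ℝ F₁] [ContMDiffVectorBundle ∞ F₁ D₁ (𝓘(ℝ, EM).prod 𝓘(ℝ, FE))]
  [FiniteDimensional ℝ F₂] [ContMDiffVectorBundle ∞ F₂ D₂ (𝓘(ℝ, EM).prod 𝓘(ℝ, FA))]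

variable (𝒟) in
theorem exists_coreChart (m : M) :
    ∃ φ : 𝒟.CoreChart (Module.finrank ℝ F₁ - Module.finrank ℝ FA), m ∈ φ.source :=
  exists_subbundleChart_ker 𝒟.contMDiff_p (contMDiff_zeroSection ℝ E)
    (fun _ => 𝒟.p_surjective _) m

variable (𝒟) in
theorem nonempty_coreBundle :
    Nonempty (𝒟.CoreBundle (Module.finrank ℝ F₁ - Module.finrank ℝ FA)) :=
  ⟨{ topology := (subbundlePrebundle 𝒟.exists_coreChart).totalSpaceTopology
     fiberBundle := (subbundlePrebundle 𝒟.exists_coreChart).toFiberBundle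
     vectorBundle := (subbundlePrebundle 𝒟.exists_coreChart).toVectorBundle
     contMDiffVectorBundle :=
      (subbundlePrebundle 𝒟.exists_coreChart).contMDiffVectorBundle 𝓘(ℝ, EM)
     contMDiff_coreIncl := contMDiff_subbundlePrebundle_incl 𝒟.exists_coreChart }⟩

variable [T2Space M] [FiniteDimensional ℝ EM] [IsManifold 𝓘(ℝ, EM) ∞ M]

variable (𝒟) in
theorem exists_smul_eq_sum_core (m₀ : M) :
    ∃ χ : C^∞⟮𝓘(ℝ, EM), M; ℝ⟯, χ m₀ = 1 ∧ ∃ (k : ℕ) (b : Fin k → (m : M) → 𝒟.Core m),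
      (∀ l, ContMDiff 𝓘(ℝ, EM) ((𝓘(ℝ, EM).prod 𝓘(ℝ, FE)).prod 𝓘(ℝ, F₁)) ∞
        fun m => 𝒟.coreIncl m (χ m • b l m)) ∧
      ∀ c : (e : TotalSpace FE E) → 𝒟.Core e.proj,
        ContMDiff (𝓘(ℝ, EM).prod 𝓘(ℝ, FE)) ((𝓘(ℝ, EM).prod 𝓘(ℝ, FE)).prod 𝓘(ℝ, F₁)) ∞
          (fun e => 𝒟.coreIncl e.proj (c e)) →
        ∃ g : Fin k → C^∞⟮𝓘(ℝ, EM).prod 𝓘(ℝ, FE), TotalSpace FE E; ℝ⟯,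
          ∀ e, χ e.proj • c e = ∑ l, g l e • b l e.proj := by
  obtain ⟨φ, hφ⟩ := 𝒟.exists_coreChart m₀
  obtain ⟨χ, -, hχ⟩ := (SmoothBumpFunction.nhds_basis_tsupport (I := 𝓘(ℝ, EM)) m₀).mem_iff.1
    (φ.isOpen_source.mem_nhds hφ)
  refine ⟨⟨χ, χ.contMDiff⟩, χ.eq_one, _, fun l m => φ.frame m (Pi.basisFun ℝ _ l),
    fun l => φ.contMDiff_smul_frame (contMDiff_zeroSection ℝ E) χ.contMDiff hχ _, fun c hc =>
    ⟨fun l => ⟨_, φ.contMDiff_mul_coord (contMDiff_proj E) χ.contMDiff hχ hc l⟩, fun e => ?_⟩⟩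
  change χ e.proj • c e = ∑ l, (χ e.proj * φ.coord ⟨e.proj, 0⟩ (c e) l) •
    (φ.frame e.proj (Pi.basisFun ℝ _ l) : 𝒟.Core e.proj)
  by_cases he : e.proj ∈ tsupport χ
  · simp only [mul_smul, ← Finset.smul_sum]
    exact congrArg (χ e.proj • ·) (φ.sum_coord_smul_frame (hχ he) (c e)).symm
  · simp only [image_eq_zero_of_notMem_tsupport he, zero_mul, zero_smul, Finset.sum_const_zero]
    rfl

theorem exists_smul_eq_sum_coreSection {Y : Cₛ^∞⟮𝓘(ℝ, EM).prod 𝓘(ℝ, FE); F₁, D₁⟯}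
    (hY : ∀ e, 𝒟.p e (Y e) = 0) (e₀ : TotalSpace FE E) :
    ∃ u : C^∞⟮𝓘(ℝ, EM).prod 𝓘(ℝ, FE), TotalSpace FE E; ℝ⟯, u e₀ = 1 ∧ ∃ (k : ℕ)
      (g : Fin k → C^∞⟮𝓘(ℝ, EM).prod 𝓘(ℝ, FE), TotalSpace FE E; ℝ⟯)
      (K : Fin k → Cₛ^∞⟮𝓘(ℝ, EM).prod 𝓘(ℝ, FE); F₁, D₁⟯),
      (∀ l, 𝒟.IsCoreSection (K l)) ∧ ∀ e, u e • Y e = ∑ l, g l e • K l e := by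
  obtain ⟨χ, hχ, k, b, hb, hspan⟩ := 𝒟.exists_smul_eq_sum_core e₀.proj
  have hYcore (e : TotalSpace FE E) : ∃ c : 𝒟.Core e.proj, 𝒟.kernelIncl e c = Y e :=
    (range_kernelIncl e).ge (hY e)
  choose c hc using hYcore
  obtain ⟨g, hg⟩ := hspan c fun e =>
    contMDiffAt_coreIncl contMDiffAt_id (by simpa only [hc] using Y.contMDiff e)
  have hχE : ContMDiff (𝓘(ℝ, EM).prod 𝓘(ℝ, FE)) 𝓘(ℝ, ℝ) ∞
      (fun e : TotalSpace FE E => χ e.proj) := χ.contMDiff.comp (contMDiff_proj E)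
  refine ⟨⟨fun e => χ e.proj * χ e.proj, hχE.mul hχE⟩, ?_, k, g, fun l => 𝒟.coreSection _ (hb l),
    fun l => isCoreSection_coreSection _ (hb l), fun e => ?_⟩
  · exact (congrArg₂ (· * ·) hχ hχ).trans (one_mul 1)
  · calc (χ e.proj * χ e.proj) • Y e
        = χ e.proj • 𝒟.kernelIncl e (χ e.proj • c e) := by rw [map_smul, hc, mul_smul]
      _ = ∑ l, g l e • 𝒟.kernelIncl e (χ e.proj • b l e.proj) := by
        simp only [hg, map_sum, map_smul, Finset.smul_sum, smul_comm (χ e.proj)]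

theorem p_bracket_eq_zero_of_core
    {LD : LieAlgebroid (𝓘(ℝ, EM).prod 𝓘(ℝ, FE)) F₁ D₁}
    {S Y : Cₛ^∞⟮𝓘(ℝ, EM).prod 𝓘(ℝ, FE); F₁, D₁⟯}
    (hS : ∀ K, 𝒟.IsCoreSection K → ∀ e, 𝒟.p e (LD.bracket S K e) = 0)
    (hY : ∀ e, 𝒟.p e (Y e) = 0) (e : TotalSpace FE E) : 𝒟.p e (LD.bracket S Y e) = 0 := by
  obtain ⟨u, hu, k, g, K, hK, h⟩ := exists_smul_eq_sum_coreSection hY e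
  exact LD.map_bracket_eq_zero_of_sum hu h (hY e) (fun l => p_eq_zero_of_isCoreSection (hK l) e)
    fun l => hS _ (hK l) e

end CoreFrames

end DoubleVectorBundle

/-! ### VB-algebroids -/

open DoubleVectorBundle

namespace IsVBAlgebroid

variable {EM : Type*} [NormedAddCommGroup EM] [NormedSpace ℝ EM] [FiniteDimensional ℝ EM]
  {M : Type*} [TopologicalSpace M] [T2Space M] [ChartedSpace EM M] [IsManifold 𝓘(ℝ, EM) ∞ M]
  {FA : Type*} [NormedAddCommGroup FA] [NormedSpace ℝ FA]
  {A : M → Type*} [TopologicalSpace (TotalSpace FA A)]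
  [∀ m, AddCommGroup (A m)] [∀ m, Module ℝ (A m)] [∀ m, TopologicalSpace (A m)]
  [FiberBundle FA A] [VectorBundle ℝ FA A]
  {FE : Type*} [NormedAddCommGroup FE] [NormedSpace ℝ FE] [FiniteDimensional ℝ FE]
  {E : M → Type*} [TopologicalSpace (TotalSpace FE E)]
  [∀ m, AddCommGroup (E m)] [∀ m, Module ℝ (E m)] [∀ m, TopologicalSpace (E m)]
  [FiberBundle FE E] [VectorBundle ℝ FE E] [ContMDiffVectorBundle ∞ FE E 𝓘(ℝ, EM)]
  {F₁ : Type*} [NormedAddCommGroup F₁] [NormedSpace ℝ F₁]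
  {D₁ : TotalSpace FE E → Type*} [TopologicalSpace (TotalSpace F₁ D₁)]
  [∀ e, AddCommGroup (D₁ e)] [∀ e, Module ℝ (D₁ e)] [∀ e, TopologicalSpace (D₁ e)]
  [FiberBundle F₁ D₁] [VectorBundle ℝ F₁ D₁]
  {F₂ : Type*} [NormedAddCommGroup F₂] [NormedSpace ℝ F₂]
  {D₂ : TotalSpace FA A → Type*} [TopologicalSpace (TotalSpace F₂ D₂)]
  [∀ a, AddCommGroup (D₂ a)] [∀ a, Module ℝ (D₂ a)] [∀ a, TopologicalSpace (D₂ a)]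
  [FiberBundle F₂ D₂]
  {𝒟 : DoubleVectorBundle (EM := EM) FA A FE E F₁ D₁ F₂ D₂}
  {LD : LieAlgebroid (𝓘(ℝ, EM).prod 𝓘(ℝ, FE)) F₁ D₁} {LA : LieAlgebroid 𝓘(ℝ, EM) FA A}
  (h : IsVBAlgebroid 𝒟 LD LA)
  {X Y : Cₛ^∞⟮𝓘(ℝ, EM).prod 𝓘(ℝ, FE); F₁, D₁⟯} {a : Cₛ^∞⟮𝓘(ℝ, EM); FA, A⟯}

include h

theorem isCompleteVectorField_of_isLinearSection (hX : 𝒟.IsLinearSection X a)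
    (ha : IsCompleteVectorField 𝓘(ℝ, EM) (LA.anchorField a)) :
    IsCompleteVectorField (𝓘(ℝ, EM).prod 𝓘(ℝ, FE)) (LD.anchorField X) := by
  have hhom : IsHomogeneousVectorField (LD.anchorField X) := fun t e => by
    have hanchor := h.anchor_smul t ⟨e, X e⟩
    rw [← hX.map_smul t e] at hanchor
    exact (TotalSpace.mk_inj.1 hanchor).symm
  exact hhom.isCompleteVectorField
    ((LD.contMDiff_anchor.comp X.contMDiff).of_le (mod_cast le_top))
    ((LA.contMDiff_anchor.comp a.contMDiff).of_le (mod_cast le_top))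
    (fun e => (h.anchor_covers e (X e)).trans (congrArg _ (hX.covers e))) ha

theorem isComplete_of_isLinearConnection
    {H : EhresmannConnection (𝓘(ℝ, EM).prod 𝓘(ℝ, FE)) F₁
      (TotalSpace.proj : TotalSpace FE E → M) 𝒟.p}
    (hH : 𝒟.IsLinearConnection H) : H.IsComplete LD LA := fun a ha => by
  obtain ⟨X, hXH, hX⟩ := hH a
  exact ⟨X, hXH, h.isCompleteVectorField_of_isLinearSection hX ha⟩

variable [FiniteDimensional ℝ FA] [ContMDiffVectorBundle ∞ FA A 𝓘(ℝ, EM)]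
  [FiniteDimensional ℝ F₁] [ContMDiffVectorBundle ∞ F₁ D₁ (𝓘(ℝ, EM).prod 𝓘(ℝ, FE))]
  [FiniteDimensional ℝ F₂] [VectorBundle ℝ F₂ D₂]
  [ContMDiffVectorBundle ∞ F₂ D₂ (𝓘(ℝ, EM).prod 𝓘(ℝ, FA))]

theorem p_bracket_linear_ker (hX : 𝒟.IsLinearSection X a) (hY : ∀ e, 𝒟.p e (Y e) = 0)
    (e : TotalSpace FE E) : 𝒟.p e (LD.bracket X Y e) = 0 :=
  p_bracket_eq_zero_of_core (fun K hK => p_eq_zero_of_isCoreSection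
    (h.bracket_linear_core X K a hX hK)) hY e

theorem p_bracket_ker_ker (hX : ∀ e, 𝒟.p e (X e) = 0) (hY : ∀ e, 𝒟.p e (Y e) = 0)
    (e : TotalSpace FE E) : 𝒟.p e (LD.bracket X Y e) = 0 := by
  have hXK (K) (hK : 𝒟.IsCoreSection K) (e : TotalSpace FE E) :
      𝒟.p e (LD.bracket K X e) = 0 :=
    p_bracket_eq_zero_of_core (fun K' hK' e => by
      rw [h.bracket_core_core K K' hK hK', ContMDiffSection.coe_zero, Pi.zero_apply, map_zero])
      hX e
  refine p_bracket_eq_zero_of_core (fun K hK e => ?_) hY e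
  rw [LD.bracket_swap, ContMDiffSection.coe_neg, Pi.neg_apply, map_neg, hXK K hK, neg_zero]

theorem isLieSubalgebroid_ker : LD.IsLieSubalgebroid fun e => LinearMap.ker (𝒟.p e) :=
  ⟨isSmoothSubbundle_ker 𝒟.contMDiff_p 𝒟.p_surjective,
    fun _ _ hX hY => h.p_bracket_ker_ker hX hY⟩

theorem isLieAlgebroidExtension [SecondCountableTopology M] :
    IsLieAlgebroidExtension LD LA (TotalSpace.proj : TotalSpace FE E → M) 𝒟.p where
  isMorphism := by
    obtain ⟨θ, hθ⟩ := 𝒟.exists_isLinearLiftOn_univ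
    choose hor _ hlin using hθ.isLinearConnection
    have hlift : LD.IsBracketLift 𝒟.p LA hor :=
      { map_hor := fun a => (hlin a).covers
        map_bracket_hor := fun a c =>
          (h.bracket_linear_linear _ _ _ _ (hlin a) (hlin c)).covers
        map_bracket_hor_ker := fun a _ hY => h.p_bracket_linear_ker (hlin a) hY
        map_bracket_ker_ker := fun _ _ hX hY => h.p_bracket_ker_ker hX hY }
    exact ⟨contMDiff_proj E, 𝒟.contMDiff_p, fun e d => (h.anchor_covers e d).symm,
      fun _ _ _ _ _ _ _ _ hX hY => hlift.map_bracket hX hY⟩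
  surjective_base m := ⟨⟨m, 0⟩, rfl⟩
  isSubmersion_base := isSubmersion_totalSpace_proj
  surjective_map := 𝒟.p_surjective

end IsVBAlgebroid

theorem proposition3
    {EM : Type*} [NormedAddCommGroup EM] [NormedSpace ℝ EM] [FiniteDimensional ℝ EM]
    {M : Type*} [TopologicalSpace M] [T2Space M] [SecondCountableTopology M]
    [ChartedSpace EM M] [IsManifold 𝓘(ℝ, EM) ∞ M]
    {FA : Type*} [NormedAddCommGroup FA] [NormedSpace ℝ FA] [FiniteDimensional ℝ FA]
    {A : M → Type*} [TopologicalSpace (TotalSpace FA A)]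
    [∀ m, AddCommGroup (A m)] [∀ m, Module ℝ (A m)] [∀ m, TopologicalSpace (A m)]
    [FiberBundle FA A] [VectorBundle ℝ FA A] [ContMDiffVectorBundle ∞ FA A 𝓘(ℝ, EM)]
    {FE : Type*} [NormedAddCommGroup FE] [NormedSpace ℝ FE] [FiniteDimensional ℝ FE]
    {E : M → Type*} [TopologicalSpace (TotalSpace FE E)]
    [∀ m, AddCommGroup (E m)] [∀ m, Module ℝ (E m)] [∀ m, TopologicalSpace (E m)]
    [FiberBundle FE E] [VectorBundle ℝ FE E] [ContMDiffVectorBundle ∞ FE E 𝓘(ℝ, EM)]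
    {F₁ : Type*} [NormedAddCommGroup F₁] [NormedSpace ℝ F₁] [FiniteDimensional ℝ F₁]
    {D₁ : TotalSpace FE E → Type*} [TopologicalSpace (TotalSpace F₁ D₁)]
    [∀ e, AddCommGroup (D₁ e)] [∀ e, Module ℝ (D₁ e)] [∀ e, TopologicalSpace (D₁ e)]
    [FiberBundle F₁ D₁] [VectorBundle ℝ F₁ D₁]
    [ContMDiffVectorBundle ∞ F₁ D₁ (𝓘(ℝ, EM).prod 𝓘(ℝ, FE))]
    {F₂ : Type*} [NormedAddCommGroup F₂] [NormedSpace ℝ F₂] [FiniteDimensional ℝ F₂]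
    {D₂ : TotalSpace FA A → Type*} [TopologicalSpace (TotalSpace F₂ D₂)]
    [∀ a, AddCommGroup (D₂ a)] [∀ a, Module ℝ (D₂ a)] [∀ a, TopologicalSpace (D₂ a)]
    [FiberBundle F₂ D₂] [VectorBundle ℝ F₂ D₂]
    [ContMDiffVectorBundle ∞ F₂ D₂ (𝓘(ℝ, EM).prod 𝓘(ℝ, FA))]
    (𝒟 : DoubleVectorBundle (EM := EM) FA A FE E F₁ D₁ F₂ D₂)
    (LD : LieAlgebroid (𝓘(ℝ, EM).prod 𝓘(ℝ, FE)) F₁ D₁)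
    (LA : LieAlgebroid 𝓘(ℝ, EM) FA A)
    (h𝒟 : IsVBAlgebroid 𝒟 LD LA) :
    -- `p : D → A` is a Lie algebroid fibration over `p_E : E → M`
    IsLieAlgebroidFibration LD LA (TotalSpace.proj : TotalSpace FE E → M) 𝒟.p ∧
    -- its kernel is a Lie subalgebroid of `D`, canonically identified with `p_E^* C`
    LD.IsLieSubalgebroid (fun e => LinearMap.ker (𝒟.p e)) ∧
    (∃ k, Nonempty (𝒟.CoreBundle k)) ∧
    (∀ k [𝒟.CoreBundle k], ∃ i, 𝒟.IsKernelIso k i) ∧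
    -- linear connections exist, and they are complete
    (∃ h, 𝒟.IsLinearConnection h) ∧
    (∀ h, 𝒟.IsLinearConnection h → h.IsComplete LD LA) := by
  obtain ⟨θ, hθ⟩ := 𝒟.exists_isLinearLiftOn_univ
  exact ⟨⟨h𝒟.isLieAlgebroidExtension, hθ.connection,
      h𝒟.isComplete_of_isLinearConnection hθ.isLinearConnection⟩,
    h𝒟.isLieSubalgebroid_ker, ⟨_, 𝒟.nonempty_coreBundle⟩, fun k => 𝒟.exists_isKernelIso k,
    ⟨hθ.connection, hθ.isLinearConnection⟩, fun _ => h𝒟.isComplete_of_isLinearConnection⟩
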